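/- Let $m\ge 3$ and let $W=I_2(m)$ be the dihedral group of order $2m$ with reflection representation $V=\mathbb C^2$. Write $\mathrm{Irr}(W)=\{\chi_0,\chi_1,\dots,\chi_{\lfloor (m-1)/2\rfloor},\epsilon\}$, together with $\chi_r,\chi_r'$ if $m=2r$. Here $\chi_0$ is the trivial character, $\epsilon$ is the sign character, $\chi_i$ for $1\le i<m/2$ is the two-dimensional character with value $2\cos(2\pi ik/m)$ at the rotation by $2\pi k/m$, and $\chi_r,\chi_r'$ are the two other linear characters. For a class function $f$ on $W$ put $$R(f)=\frac{(q-1)^2P_W(q)}{|W|}\sum_{w\in W}\frac{\det_V(w)f(w)}{\det_V(q-w)},\qquad P_W(q)=\frac{(q^2-1)(q^m-1)}{(q-1)^2}.$$ Let $b_\chi$ be the exponent of the largest power of $q$ dividing $R(\chi)$. Let $\Omega$ be the matrix with entries $\omega_{\chi,\chi'}=q^{m}R(\chi\otimes\chi'\otimes\overline{\det}_V)$. Let $\mathcal H$ be the one-parameter Iwahori–Hecke algebra of $W$ (relations $(T-q)(T+1)=0$ for both generators, and the braid relation), with its canonical symmetrizing trace $T_w\mapsto\delta_{w,1}$. A character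 $\chi$ is special if $b_\chi$ equals the exponent of the largest power of $q$ dividing its generic degree. Families are the blocks of $\mathcal H$ over the Rouquier ring $\mathcal O[q,q^{-1},(q^n-1)^{-1}\,(n\ge1)]$, where $\mathcal O$ is the ring of algebraic integers. A Lusztig–Shoji datum is a partition $X$ of $\mathrm{Irr}(W)$, a total order $<$ on $X$ and an order-reversing (that is, weakly decreasing) function $a:X\to\mathbb N$. The support $\mathrm{supp}\,\chi$ is the part containing $\chi$. A system of Green functions for it is a pair of matrices $P,\Lambda$, indexed by $\mathrm{Irr}(W)$, with entries rational functions over $\mathbb Z[q]$, such that $P\Lambda P^t=\Omega$; $P_{\chi,\chi'}=0$ if $\mathrm{supp}\,\chi<\mathrm{supp}\,\chi'$; $P_{\chi,\chi'}=\delta_{\chi,\chi'}q^{a_C}$ if $\mathrm{supp}\,\chi=\mathrm{supp}\,\chi'=C$; and $\Lambda_{\chi,\chi'}=0$ if $\mathrm{supp}\,\chi\ne\mathrm{supp}\,\chi'$. The datum, with such $P,\Lambda$, is a Springer correspondence if: 1. for each $C\in X$, $a_C=\min_{\chi\in C}b_\chi$, and this minimum is attained at a unique $\chi\in C$, called the Springer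 representation of $C$; 2. every special character is a Springer representation; 3. if $\chi'$ is nonspecial and in the same family as the special character $\chi$, then $\mathrm{supp}\,\chi'\le\mathrm{supp}\,\chi$; 4. the entries of $\Lambda$ are in $\mathbb Z[q]$ and those of $P$ are in $\mathbb N[q]$; 5. $q^{a_C}$ divides $P_{\chi,\chi'}$ whenever $\chi\in C$. The elements of $X$ are then called classes, and a class is special if its Springer representation is. The closure order $\preceq$ on $X$ is the transitive closure of the relation: $C'\preceq C$ if $P_{\chi,\chi'}\neq0$ for some $\chi\in C$, $\chi'\in C'$. The special piece of a special class $C$ consists of $C$ and all nonspecial classes $C'\preceq C$ with $C'\not\preceq C''$ for every special $C''\preceq C$, $C''\ne C$. Define numbers $n^i_{\chi,\chi'}$ by $P_{\chi,\chi'}=\sum_{i\ge0}n^i_{\chi,\chi'}q^{a_C+i}$ for $\chi\in C$; these play the role of the multiplicities in the cohomology sheaves $\mathcal H^i$ of intersection cohomology complexes. A set $Z$ of classes is rationally smooth if it contains a class $C$ with $C'\preceq C$ for all $C'\in Z$ and, for $\chi$ the Springer representation of $C$ and every $\chi'$ with $\mathrm{supp}\,\chi'\in Z$, one has $n^0_{\chi,\chi'}=1$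 if $\chi'$ is a Springer representation, $n^0_{\chi,\chi'}=0$ if it is not, and $n^i_{\chi,\chi'}=0$ for all $i\ge1$. **Theorem.** For every Springer correspondence of $I_2(m)$, with its system of Green functions $(P,\Lambda)$, every special piece is rationally smooth, and so is the full unipotent variety, that is, the set of all classes. Concretely, for every $\chi\ne\chi_0,\epsilon$, $P_{\chi_1,\chi}=q$ if $\chi$ is a Springer representation and $P_{\chi_1,\chi}=0$ otherwise; and for every $\chi$, $P_{\chi_0,\chi}=1$ if $\chi$ is a Springer representation and $P_{\chi_0,\chi}=0$ otherwise. -/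

import Mathlib

noncomputable section

namespace DihedralSpringer

/-! ### The dihedral group and its reflection representation -/

/-- The field `ℂ(q)`. -/
abbrev K : Type := RatFunc ℂ

/-- The indeterminate `q`. -/
def q : K := RatFunc.X

/-- `zeta k = exp (2 π i k / m)` for `k : ZMod m`. -/
def zeta {m : ℕ} [NeZero m] (k : ZMod m) : ℂ := ZMod.stdAddChar k

theorem zeta_add {m : ℕ} [NeZero m] (k l : ZMod m) : zeta (k + l) = zeta k * zeta l :=
  AddChar.map_add_eq_mul _ k l

theorem zeta_zero {m : ℕ} [NeZero m] : zeta (0 : ZMod m) = 1 :=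
  AddChar.map_zero_eq_one _

/-- The reflection representation `V = ℂ²` of the dihedral group `I₂(m)` of order `2m`:
`r k` acts as a rotation and `sr k` as a reflection. -/
def reflRep (m : ℕ) [NeZero m] : DihedralGroup m →* Matrix (Fin 2) (Fin 2) ℂ where
  toFun
    | .r k => !![zeta k, 0; 0, zeta (-k)]
    | .sr k => !![0, zeta (-k); zeta k, 0]
  map_one' := by
    change !![zeta (0 : ZMod m), 0; 0, zeta (-0 : ZMod m)] = _
    rw [neg_zero, zeta_zero, Matrix.one_fin_two]
  map_mul' := by
    rintro (i | i) (j | j) <;>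
      simp [← zeta_add, sub_eq_add_neg, add_comm]

/-! ### The irreducible characters -/

/-- Labels for the irreducible representations of `I₂(m)`:
`chi i` is `χ_i` for `0 ≤ i ≤ m / 2` (so the last one is `χ_r` when `m = 2 r`),
`chi'` is `χ_r'` (only when `m = 2 r` is even), and `eps` is the sign representation. -/
inductive Irr (m : ℕ) : Type
  | chi (i : Fin (m / 2 + 1)) : Irr m
  | chi' (h : Even m) : Irr m
  | eps : Irr m

/-- The labels as a disjoint union. -/
def Irr.equivSum (m : ℕ) : (Fin (m / 2 + 1) ⊕ PLift (Even m)) ⊕ Unit ≃ Irr m where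
  toFun
    | .inl (.inl i) => .chi i
    | .inl (.inr h) => .chi' h.down
    | .inr _ => .eps
  invFun
    | .chi i => .inl (.inl i)
    | .chi' h => .inl (.inr ⟨h⟩)
    | .eps => .inr ()
  left_inv := by rintro ((i | h) | _) <;> rfl
  right_inv := by rintro (i | h | _) <;> rfl

instance (m : ℕ) : Fintype (Irr m) := Fintype.ofEquiv _ (Irr.equivSum m)

/-- The character of `I₂(m)` with a given label. -/
def Irr.char {m : ℕ} [NeZero m] : Irr m → DihedralGroup m → ℂ
  | .chi i, .r k =>
      if i.val = 0 then 1
      else if 2 * i.val = m then (-1) ^ k.val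
      else zeta ((i.val : ZMod m) * k) + zeta (-((i.val : ZMod m) * k))
  | .chi i, .sr k =>
      if i.val = 0 then 1
      else if 2 * i.val = m then (-1) ^ k.val
      else 0
  | .chi' _, .r k => (-1) ^ k.val
  | .chi' _, .sr k => -(-1) ^ k.val
  | .eps, .r _ => 1
  | .eps, .sr _ => -1

/-! ### Fake degrees and the matrix `Ω` -/

/-- The Poincaré polynomial `∏ (q ^ dᵢ - 1) / (q - 1)`; the degrees of `I₂(m)` are `2` and `m`. -/
def poincare (m : ℕ) : K := (q ^ 2 - 1) / (q - 1) * ((q ^ m - 1) / (q - 1))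

/-- `R(f) = (q-1)^(dim V) P_W(q) / |W| * ∑_w det_V(w) f(w) / det_V(q - w)`. -/
def R {m : ℕ} [NeZero m] (f : DihedralGroup m → ℂ) : K :=
  (q - 1) ^ 2 * poincare m / (Fintype.card (DihedralGroup m) : K) *
    ∑ w : DihedralGroup m, RatFunc.C ((reflRep m w).det * f w) /
      (q • (1 : Matrix (Fin 2) (Fin 2) K) - (reflRep m w).map RatFunc.C).det

/-- The order of vanishing at `q = 0`; for a nonzero polynomial this is the exponent of the largest
power of `q` dividing it. -/
def ordZero (f : K) : ℤ := (f.num.natTrailingDegree : ℤ) - (f.denom.natTrailingDegree : ℤ)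

/-- The `b`-invariant: the exponent of the largest power of `q` dividing the fake degree. -/
def b {m : ℕ} [NeZero m] (χ : Irr m) : ℤ := ordZero (R χ.char)

/-- `ω_{χ,χ'} = q ^ N* R(χ ⊗ χ' ⊗ conj det_V)`; `I₂(m)` has `N* = m` reflections. -/
def Omega (m : ℕ) [NeZero m] : Matrix (Irr m) (Irr m) K := fun χ χ' =>
  q ^ m * R (fun w => χ.char w * χ'.char w * star (reflRep m w).det)

/-! ### The one-parameter Hecke algebra: generic degrees, special characters, families

The Hecke algebra has generators `T_s, T_t` (with `s = sr 0`, `t = sr 1`, so `s t = r 1`), the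
quadratic relations `(T - q)(T + 1) = 0` and the braid relation of length `m`.  Its canonical
symmetrizing trace is `T_w ↦ δ_{w,1}`. -/

/-- The alternating word of length `n` whose first letter is `x`
(`true` stands for `s`, `false` for `t`). -/
def altWord : Bool → ℕ → List Bool
  | _, 0 => []
  | x, n + 1 => x :: altWord (!x) n

/-- A reduced word for an element of the dihedral group. -/
def redWord {m : ℕ} : DihedralGroup m → List Bool
  | .r k => if k.val ≤ (-k).val then altWord true (2 * k.val) else altWord false (2 * (-k).val)
  | .sr k =>
      if k = 0 ∨ (-k).val < k.val then altWord true (2 * (-k).val + 1)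
      else altWord false (2 * k.val - 1)

/-- The Coxeter length. -/
def len {m : ℕ} (w : DihedralGroup m) : ℕ := (redWord w).length

/-- The image of `T_w` when `T_s, T_t` are sent to `S, T`. -/
def evalWord {M : Type} [Monoid M] {m : ℕ} (S T : M) (w : DihedralGroup m) : M :=
  ((redWord w).map (fun x => if x then S else T)).prod

/-- The value at `T_w` of the irreducible character of the Hecke algebra over `ℂ(q)` which
specializes at `q = 1` to the character with the given label.  The one-dimensional ones send each
generator to `q` or `-1`; the two-dimensional ones are given by explicit matrices for `T_s, T_t`. -/
def heckeChar {m : ℕ} [NeZero m] : Irr m → DihedralGroup m → K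
  | .chi i, w =>
      if i.val = 0 then evalWord q q w
      else if 2 * i.val = m then evalWord q (-1) w
      else (evalWord
        !![-1, 0; 1, q]
        !![q, q * RatFunc.C (2 + zeta (i.val : ZMod m) + zeta (-(i.val : ZMod m))); 0, -1]
        w).trace
  | .chi' _, w => evalWord (-1) q w
  | .eps, w => evalWord (-1) (-1) w

/-- The Schur element of an irreducible character of the Hecke algebra with respect to the canonical
symmetrizing trace (the basis dual to `T_w` is `q ^ (-len w) T_{w⁻¹}`). -/
def schurElt {m : ℕ} [NeZero m] (χ : Irr m) : K :=
  (∑ w : DihedralGroup m, (q ^ len w)⁻¹ * heckeChar χ w * heckeChar χ w⁻¹) / heckeChar χ 1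

/-- The generic degree. -/
def genericDegree {m : ℕ} [NeZero m] (χ : Irr m) : K := poincare m / schurElt χ

/-- A character is special if its fake degree and its generic degree are divisible by the same
largest power of `q`. -/
def IsSpecial {m : ℕ} [NeZero m] (χ : Irr m) : Prop := b χ = ordZero (genericDegree χ)

/-- The Rouquier ring `𝒪[q, q⁻¹, (q ^ n - 1)⁻¹ (n ≥ 1)]`, with `𝒪` the algebraic integers. -/
def rouquierRing : Subring K :=
  Subring.closure (RatFunc.C '' {z : ℂ | IsIntegral ℤ z} ∪ {q, q⁻¹} ∪
    {x | ∃ n : ℕ, 1 ≤ n ∧ x = (q ^ n - 1)⁻¹})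

/-- The central idempotent `∑_{χ ∈ B} (1 / s_χ) ∑_w χ(T_w) q ^ (-len w) T_{w⁻¹}` of the Hecke algebra
over `ℂ(q)` has its coefficients in the Rouquier ring. -/
def IsIntegralIdempotent {m : ℕ} [NeZero m] (B : Finset (Irr m)) : Prop :=
  ∀ w : DihedralGroup m,
    ∑ χ ∈ B, (schurElt χ)⁻¹ * heckeChar χ w * (q ^ len w)⁻¹ ∈ rouquierRing

/-- Two characters are in the same family if they lie in the same block of the Hecke algebra over the
Rouquier ring, that is, if no central idempotent over that ring separates them. -/
def SameFamily {m : ℕ} [NeZero m] (χ χ' : Irr m) : Prop :=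
  ∀ B : Finset (Irr m), IsIntegralIdempotent B → (χ ∈ B ↔ χ' ∈ B)

/-! ### Lusztig–Shoji data and Green functions -/

/-- A Lusztig–Shoji datum on an index set `I` of irreducible characters: a partition of `I` (its parts
are the fibres of the surjection `supp : I → X`), a total order on the set `X` of parts, and an
order-reversing function `a : X → ℕ`. -/
structure LSDatum (I : Type) where
  X : Type
  order : LinearOrder X
  supp : I → X
  supp_surjective : Function.Surjective supp
  a : X → ℕ
  antitone_a : Antitone a

attribute [instance] LSDatum.order

/-- A quotient of two polynomials with integer coefficients. -/
def IsRationalOverInt (x : K) : Prop :=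
  ∃ f g : Polynomial ℤ, g ≠ 0 ∧
    x = algebraMap (Polynomial ℂ) K (f.map (Int.castRingHom ℂ)) /
      algebraMap (Polynomial ℂ) K (g.map (Int.castRingHom ℂ))

/-- A polynomial with integer coefficients. -/
def IsIntPoly (x : K) : Prop :=
  ∃ f : Polynomial ℤ, x = algebraMap (Polynomial ℂ) K (f.map (Int.castRingHom ℂ))

/-- A polynomial with nonnegative integer coefficients. -/
def IsNatPoly (x : K) : Prop :=
  ∃ f : Polynomial ℕ, x = algebraMap (Polynomial ℂ) K (f.map (Nat.castRingHom ℂ))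

/-- `(P, Λ)` is a system of Green functions for the datum `D`. -/
structure IsGreenSystem {m : ℕ} [NeZero m] (D : LSDatum (Irr m))
    (P Λ : Matrix (Irr m) (Irr m) K) : Prop where
  rational_P : ∀ χ χ', IsRationalOverInt (P χ χ')
  rational_Λ : ∀ χ χ', IsRationalOverInt (Λ χ χ')
  equation : P * Λ * P.transpose = Omega m
  P_lt : ∀ χ χ', D.supp χ < D.supp χ' → P χ χ' = 0
  P_diag : ∀ χ, P χ χ = q ^ D.a (D.supp χ)
  P_block : ∀ χ χ', D.supp χ = D.supp χ' → χ ≠ χ' → P χ χ' = 0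
  Λ_block : ∀ χ χ', D.supp χ ≠ D.supp χ' → Λ χ χ' = 0

/-- `χ` is a Springer representation: `b` attains at `χ` its minimum on the class of `χ`. -/
def IsSpringerRep {m : ℕ} [NeZero m] (D : LSDatum (Irr m)) (χ : Irr m) : Prop :=
  ∀ ψ, D.supp ψ = D.supp χ → b χ ≤ b ψ

/-- The datum `D`, with its system of Green functions `(P, Λ)`, is a Springer correspondence. -/
structure IsSpringerCorrespondence {m : ℕ} [NeZero m] (D : LSDatum (Irr m))
    (P Λ : Matrix (Irr m) (Irr m) K) : Prop where
  green : IsGreenSystem D P Λ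
  a_eq_min : ∀ C, IsLeast {n : ℤ | ∃ χ, D.supp χ = C ∧ b χ = n} (D.a C : ℤ)
  unique_springer : ∀ C, ∃! χ, D.supp χ = C ∧ IsSpringerRep D χ
  special_springer : ∀ χ, IsSpecial χ → IsSpringerRep D χ
  family_le : ∀ χ χ', IsSpecial χ → ¬ IsSpecial χ' → SameFamily χ' χ → D.supp χ' ≤ D.supp χ
  intPoly_Λ : ∀ χ χ', IsIntPoly (Λ χ χ')
  natPoly_P : ∀ χ χ', IsNatPoly (P χ χ')
  dvd_P : ∀ χ χ', ∃ y, IsIntPoly y ∧ P χ χ' = q ^ D.a (D.supp χ) * y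

/-! ### Closure order, special pieces, rational smoothness -/

/-- The closure order on classes: `C' ≼ C` is the transitive closure of the relation
"`P_{χ,χ'} ≠ 0` for some `χ ∈ C` and `χ' ∈ C'`".  -/
def ClosureLE {m : ℕ} (D : LSDatum (Irr m)) (P : Matrix (Irr m) (Irr m) K) : D.X → D.X → Prop :=
  Relation.TransGen (fun C' C => ∃ χ χ', D.supp χ = C ∧ D.supp χ' = C' ∧ P χ χ' ≠ 0)

/-- A class is special if its Springer representation is. -/
def IsSpecialClass {m : ℕ} [NeZero m] (D : LSDatum (Irr m)) (C : D.X) : Prop :=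
  ∃ χ, D.supp χ = C ∧ IsSpringerRep D χ ∧ IsSpecial χ

/-- The special piece of a special class `C`: the class `C` together with the nonspecial classes in its
closure that are not in the closure of any smaller special class. -/
def specialPiece {m : ℕ} [NeZero m] (D : LSDatum (Irr m)) (P : Matrix (Irr m) (Irr m) K)
    (C : D.X) : Set D.X :=
  {C' | C' = C ∨ (¬ IsSpecialClass D C' ∧ ClosureLE D P C' C ∧
    ∀ C'', IsSpecialClass D C'' → ClosureLE D P C'' C → C'' ≠ C → ¬ ClosureLE D P C' C'')}

/-- The multiplicity `[ℰ' : ℋ^i IC(closure of C, ℰ)]`, where `χ, χ'` correspond to the local systems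
`ℰ` on `C` and `ℰ'` on `C'`: it is read off from
`P_{χ,χ'} = ∑_{i ≥ 0} [ℰ' : ℋ^i IC(closure of C, ℰ)] q ^ (a(C) + i)`. -/
def icMult {m : ℕ} (D : LSDatum (Irr m)) (P : Matrix (Irr m) (Irr m) K)
    (χ χ' : Irr m) (i : ℕ) : ℂ :=
  (P χ χ').num.coeff (D.a (D.supp χ) + i)

/-- Rational smoothness of the union `Z` of a set of classes.  `Z` has a dense class `C`, and
`IC(Z) = IC(closure of C, trivial local system)` restricted to `Z` has the trivial local system as
its cohomology sheaf in degree `0` and no other cohomology, on each class of `Z`.  The trivial local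
system on a class corresponds to the Springer representation of that class. -/
def RationallySmooth {m : ℕ} [NeZero m] (D : LSDatum (Irr m)) (P : Matrix (Irr m) (Irr m) K)
    (Z : Set D.X) : Prop :=
  ∃ C ∈ Z, (∀ C' ∈ Z, ClosureLE D P C' C) ∧
    ∀ χ, D.supp χ = C → IsSpringerRep D χ →
      ∀ χ', D.supp χ' ∈ Z →
        (IsSpringerRep D χ' → icMult D P χ χ' 0 = 1) ∧
        (¬ IsSpringerRep D χ' → icMult D P χ χ' 0 = 0) ∧
        ∀ i : ℕ, 1 ≤ i → icMult D P χ χ' i = 0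

end DihedralSpringer

end

open DihedralSpringer

/-! The theorem comes from a partial proportionality between rows of `Omega`. The sign character ε
has the largest b-invariant, so its class is a singleton at the bottom of the order. Its
contribution to P Λ Pᵗ = Ω is explicit: Λ_{ε,ε} = 1 and P_{χ,ε} = R(χ). Removing it replaces Ω_{χ,ψ}
by Ω_{χ,ψ} - R(χ)R(ψ). For a two-dimensional χ_k and ψ of index at least k, this reduced entry is
q^k times the corresponding entry for χ_0 (`Omega_sub_of_idx_le`).

On a class C other than that of ε, every index is at least a_C, so the proportionality holds on all
classes with a_C ≥ k, and these form a lower set. Since Ω is invertible (`det_Omega_ne_zero`), so is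
Λ, and block triangularity allows cancellation class by class (`IsGreenSystem.eq_zero_of_vecMul`).
Hence P_{χ_k,φ} = q^k P_{χ_0,φ} on these classes, away from ε (`IsSpringerCorrespondence.P_eq_mul`).

If χ_k is the Springer representation of C, then a_C = k and the row of χ_k on C is q^k at χ_k and 0
elsewhere. Dividing by q^k gives the row of χ_0 on C; the case k = 1 then gives the row of χ_1. The
characters of index m/2 do not satisfy the proportionality among themselves and are treated apart
(`IsSpringerCorrespondence.P_chi_zero_of_two_mul_idx`).

Comparison of fake and generic degrees shows that only χ_0, χ_1 and ε are special (`isSpecial_iff`),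
so these rows control every special piece. -/

noncomputable section

namespace DihedralSpringer

/-! ### Nonvanishing in ℂ(q) and character sums over `ZMod m` -/

open Polynomial in
theorem q_sub_C_ne_zero (z : ℂ) : q - RatFunc.C z ≠ 0 := by
  have h : q - RatFunc.C z = algebraMap (Polynomial ℂ) K (X - C z) := by simp [q]
  rw [h]
  exact RatFunc.algebraMap_ne_zero (X_sub_C_ne_zero z)

theorem q_ne_zero : q ≠ 0 := RatFunc.X_ne_zero

theorem q_pow_sub_one_ne_zero {n : ℕ} (hn : 0 < n) : q ^ n - 1 ≠ 0 := by
  have h : q ^ n - 1 = algebraMap (Polynomial ℂ) K (Polynomial.X ^ n - Polynomial.C 1) := by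
    simp [q]
  rw [h]
  exact RatFunc.algebraMap_ne_zero (Polynomial.X_pow_sub_C_ne_zero hn 1)

instance : CharZero K := charZero_of_injective_algebraMap (RatFunc.C : ℂ →+* K).injective

theorem sum_dihedral {m : ℕ} [NeZero m] {A : Type*} [AddCommMonoid A] (f : DihedralGroup m → A) :
    ∑ w, f w = ∑ k, f (.r k) + ∑ k, f (.sr k) := by
  rw [← DihedralGroup.equivSum.symm.sum_comp f, Fintype.sum_sum_type]
  rfl

theorem sum_zmod_val {m : ℕ} [NeZero m] {A : Type*} [AddCommMonoid A] (f : ℕ → A) :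
    ∑ k : ZMod m, f k.val = ∑ l ∈ Finset.range m, f l := by
  refine Finset.sum_bij (fun k _ => k.val) ?_ ?_ ?_ ?_
  · intro k _
    exact Finset.mem_range.2 k.val_lt
  · intro k _ l _ h
    exact ZMod.val_injective m h
  · intro l hl
    exact ⟨l, Finset.mem_univ _, ZMod.val_cast_of_lt (Finset.mem_range.1 hl)⟩
  · intros; rfl

theorem zeta_mul_zeta_neg {m : ℕ} [NeZero m] (k : ZMod m) : zeta k * zeta (-k) = 1 := by
  rw [← zeta_add, add_neg_cancel, zeta_zero]

theorem zeta_nsmul {m : ℕ} [NeZero m] (n : ℕ) (k : ZMod m) :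
    zeta ((n : ZMod m) * k) = zeta k ^ n := by
  rw [← nsmul_eq_mul]
  exact AddChar.map_nsmul_eq_pow _ n k

theorem zeta_pow_card {m : ℕ} [NeZero m] (k : ZMod m) : zeta k ^ m = 1 := by
  rw [← zeta_nsmul, CharP.cast_eq_zero, zero_mul, zeta_zero]

theorem sum_zeta_mul {m : ℕ} [NeZero m] (n : ZMod m) :
    ∑ k, zeta (n * k) = if n = 0 then (m : ℂ) else 0 := by
  have := AddChar.sum_mulShift n (ZMod.isPrimitive_stdAddChar m)
  simp only [ZMod.card] at this
  simp_rw [zeta, mul_comm n]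
  rw [this]
  push_cast
  rfl

theorem neg_one_pow_val {m : ℕ} [NeZero m] {n : ℕ} (hn : 2 * n = m) (k : ZMod m) :
    (-1 : ℂ) ^ k.val = zeta ((n : ZMod m) * k) := by
  have h1 : zeta (n : ZMod m) = -1 := by
    have h2 : zeta (n : ZMod m) ^ 2 = 1 := by
      rw [← zeta_nsmul, ← Nat.cast_mul, hn, CharP.cast_eq_zero, zeta_zero]
    rcases eq_or_eq_neg_of_sq_eq_sq _ 1 (h2.trans (one_pow 2).symm) with h | h
    -- Injectivity of the standard character would make m divide n, impossible as 0 < n < m.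
    · exfalso
      have h3 : (n : ZMod m) = 0 :=
        ZMod.injective_stdAddChar (h.trans (zeta_zero (m := m)).symm)
      rw [ZMod.natCast_eq_zero_iff] at h3
      have := NeZero.ne m
      have := Nat.le_of_dvd (by omega) h3
      omega
    · exact h
  rw [← h1, ← zeta_nsmul, ZMod.natCast_zmod_val, mul_comm]

/-! ### Molien sums -/

/-- `q ^ n + q ^ (m - n)`, with `n` taken modulo `m`. -/
def palin {m : ℕ} (x : ZMod m) : K := q ^ x.val + q ^ (m - x.val)

theorem palin_natCast {m : ℕ} [NeZero m] {n : ℕ} (hn : n ≤ m) :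
    palin (n : ZMod m) = q ^ n + q ^ (m - n) := by
  rcases hn.lt_or_eq with h | rfl
  · rw [palin, ZMod.val_cast_of_lt h]
  · simp [palin, add_comm]

theorem palin_neg {m : ℕ} [NeZero m] (x : ZMod m) : palin (-x) = palin x := by
  by_cases h : x = 0
  · simp [h]
  · have := x.val_lt
    rw [palin, palin, ZMod.neg_val, if_neg h, add_comm]
    congr 2
    omega

/-- Both halves are geometric sums that close up because z'^m = 1: the first, times x - z, is z(x^m
- 1), and the second, times x - z', is x(x^m - 1). Then (x - z')z + (x - z)x = x² - 1. -/
theorem mul_sum_inv_pow_palin {F : Type*} [Field F] {m : ℕ} {x z z' : F} (hz : z * z' = 1)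
    (hm : z' ^ m = 1) :
    (x - z) * (x - z') * ∑ l ∈ Finset.range m, z' ^ l * (x ^ l + x ^ (m - l)) =
      (x ^ 2 - 1) * (x ^ m - 1) := by
  have h1 : (x - z) * ∑ l ∈ Finset.range m, z' ^ l * x ^ l = z * (x ^ m - 1) := by
    have h := geom_sum_mul (z' * x) m
    simp_rw [mul_pow, hm] at h
    linear_combination z * h + (-x * ∑ l ∈ Finset.range m, z' ^ l * x ^ l) * hz
  have h2 : (x - z') * ∑ l ∈ Finset.range m, z' ^ l * x ^ (m - l) = x * (x ^ m - 1) := by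
    have h := (Commute.all z' x).geom_sum₂_mul m
    rw [hm] at h
    have h3 : ∑ l ∈ Finset.range m, z' ^ l * x ^ (m - l) =
        x * ∑ l ∈ Finset.range m, z' ^ l * x ^ (m - 1 - l) := by
      rw [Finset.mul_sum]
      refine Finset.sum_congr rfl fun l hl => ?_
      have : m - l = m - 1 - l + 1 := by have := Finset.mem_range.1 hl; omega
      rw [this, pow_succ]
      ring
    rw [h3]
    linear_combination -x * h
  simp_rw [mul_add, Finset.sum_add_distrib]
  linear_combination (x - z') * h1 + (x - z) * h2 - (x ^ m - 1) * hz

theorem sum_zeta_palin {m : ℕ} [NeZero m] (k : ZMod m) :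
    (q - RatFunc.C (zeta k)) * (q - RatFunc.C (zeta (-k))) *
      ∑ l : ZMod m, RatFunc.C (zeta (-(l * k))) * palin l = (q ^ 2 - 1) * (q ^ m - 1) := by
  have h := mul_sum_inv_pow_palin (x := q) (m := m) (z := RatFunc.C (zeta k))
    (z' := RatFunc.C (zeta (-k))) (by rw [← map_mul, zeta_mul_zeta_neg, map_one])
    (by rw [← map_pow, zeta_pow_card, map_one])
  rw [← h, ← sum_zmod_val (fun l => RatFunc.C (zeta (-k)) ^ l * (q ^ l + q ^ (m - l)))]
  congr 1
  refine Finset.sum_congr rfl fun l _ => ?_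
  rw [← map_pow, ← zeta_nsmul, ZMod.natCast_zmod_val, mul_neg, palin]

/-- The contribution of the rotations to the Molien sum. -/
theorem sum_zeta_div {m : ℕ} [NeZero m] (n : ZMod m) :
    (q ^ 2 - 1) * (q ^ m - 1) * ∑ k : ZMod m, RatFunc.C (zeta (n * k)) /
      ((q - RatFunc.C (zeta k)) * (q - RatFunc.C (zeta (-k)))) = m * palin n := by
  rw [Finset.mul_sum]
  have h : ∀ k : ZMod m, (q ^ 2 - 1) * (q ^ m - 1) * (RatFunc.C (zeta (n * k)) /
      ((q - RatFunc.C (zeta k)) * (q - RatFunc.C (zeta (-k))))) =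
      ∑ l : ZMod m, RatFunc.C (zeta ((n - l) * k)) * palin l := by
    intro k
    rw [← sum_zeta_palin k]
    have h1 := q_sub_C_ne_zero (zeta k)
    have h2 := q_sub_C_ne_zero (zeta (-k))
    field_simp
    rw [Finset.sum_mul]
    refine Finset.sum_congr rfl fun l _ => ?_
    rw [sub_mul, sub_eq_add_neg, zeta_add, map_mul]
    ring
  -- Each summand is now a finite Fourier expansion in k; exchanging the sums and using
  -- orthogonality leaves only l = n.
  simp_rw [h]
  rw [Finset.sum_comm]
  simp_rw [← Finset.sum_mul, ← map_sum, sum_zeta_mul, sub_eq_zero]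
  rw [Finset.sum_eq_single n]
  · simp
  · intro l _ hl
    rw [if_neg hl.symm, map_zero, zero_mul]
  · simp

/-- A rotation has determinant 1 and eigenvalues ζ^k, ζ^(-k). Every reflection has determinant -1
and characteristic polynomial q² - 1, so only the sum of f over the reflections matters. -/
theorem R_eq {m : ℕ} [NeZero m] (f : DihedralGroup m → ℂ) :
    R f = (2 * m : K)⁻¹ * ((q ^ 2 - 1) * (q ^ m - 1) * ∑ k : ZMod m, RatFunc.C (f (.r k)) /
      ((q - RatFunc.C (zeta k)) * (q - RatFunc.C (zeta (-k))))
      - (q ^ m - 1) * RatFunc.C (∑ k, f (.sr k))) := by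
  have h1 : q - 1 ≠ 0 := by simpa using q_pow_sub_one_ne_zero one_pos
  have h2 : q ^ 2 - 1 ≠ 0 := q_pow_sub_one_ne_zero two_pos
  have hm : (m : K) ≠ 0 := Nat.cast_ne_zero.2 (NeZero.ne m)
  have hr : ∀ k : ZMod m, RatFunc.C ((reflRep m (.r k)).det * f (.r k)) /
      (q • (1 : Matrix (Fin 2) (Fin 2) K) - (reflRep m (.r k)).map RatFunc.C).det =
      RatFunc.C (f (.r k)) / ((q - RatFunc.C (zeta k)) * (q - RatFunc.C (zeta (-k)))) := by
    intro k
    have h : (reflRep m (.r k)).det = 1 := by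
      simp [reflRep, zeta_mul_zeta_neg]
    rw [h, one_mul]
    congr 1
    simp [reflRep, Matrix.det_fin_two]
  have hsr : ∀ k : ZMod m, RatFunc.C ((reflRep m (.sr k)).det * f (.sr k)) /
      (q • (1 : Matrix (Fin 2) (Fin 2) K) - (reflRep m (.sr k)).map RatFunc.C).det =
      - (RatFunc.C (f (.sr k)) / (q ^ 2 - 1)) := by
    intro k
    have h : (reflRep m (.sr k)).det = -1 := by
      simp [reflRep, mul_comm, zeta_mul_zeta_neg]
    have h' : (q • (1 : Matrix (Fin 2) (Fin 2) K) - (reflRep m (.sr k)).map RatFunc.C).det =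
        q ^ 2 - 1 := by
      simp [reflRep, Matrix.det_fin_two, ← map_mul, mul_comm, zeta_mul_zeta_neg, sq]
    rw [h, h']
    simp
    ring
  rw [R, sum_dihedral, Finset.sum_congr rfl fun k _ => hr k, Finset.sum_congr rfl fun k _ => hsr k,
    Finset.sum_neg_distrib, ← Finset.sum_div, ← map_sum, poincare, DihedralGroup.card]
  push_cast
  field_simp
  ring

/-- Molien sum of a function which is a combination of `ζ ^ (±x k)` and `ζ ^ (±y k)` on the
rotations. -/
theorem R_of_rot {m : ℕ} [NeZero m] {f : DihedralGroup m → ℂ} {x y : ZMod m} {c s : ℂ}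
    (hr : ∀ k, f (.r k) = c * (zeta (x * k) + zeta (-(x * k)) + (zeta (y * k) + zeta (-(y * k)))))
    (hs : ∑ k, f (.sr k) = m * s) :
    R f = RatFunc.C c * (palin x + palin y) - (q ^ m - 1) / 2 * RatFunc.C s := by
  have hm : (m : K) ≠ 0 := Nat.cast_ne_zero.2 (NeZero.ne m)
  have h : ∀ k : ZMod m, RatFunc.C (f (.r k)) /
      ((q - RatFunc.C (zeta k)) * (q - RatFunc.C (zeta (-k)))) =
      RatFunc.C c * (RatFunc.C (zeta (x * k)) /
        ((q - RatFunc.C (zeta k)) * (q - RatFunc.C (zeta (-k)))) +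
        RatFunc.C (zeta (-x * k)) /
        ((q - RatFunc.C (zeta k)) * (q - RatFunc.C (zeta (-k)))) +
        (RatFunc.C (zeta (y * k)) /
        ((q - RatFunc.C (zeta k)) * (q - RatFunc.C (zeta (-k)))) +
        RatFunc.C (zeta (-y * k)) /
        ((q - RatFunc.C (zeta k)) * (q - RatFunc.C (zeta (-k)))))) := by
    intro k
    rw [hr, map_mul, map_add, map_add, map_add, neg_mul, neg_mul]
    ring
  rw [R_eq, hs, Finset.sum_congr rfl fun k _ => h k, ← Finset.mul_sum, Finset.sum_add_distrib,
    Finset.sum_add_distrib, Finset.sum_add_distrib, mul_left_comm,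
    mul_add (_ * _), mul_add (_ * _), mul_add (_ * _), sum_zeta_div, sum_zeta_div, sum_zeta_div,
    sum_zeta_div, palin_neg, palin_neg, map_mul,
    map_natCast]
  field_simp
  ring

/-! ### Uniform formulas for the characters and for `Omega` -/

/-- The exponent `n` such that the character is a multiple of `ζ ^ (n k) + ζ ^ (-n k)` on the
rotations. -/
def Irr.idx {m : ℕ} : Irr m → ℕ
  | .chi i => i.val
  | .chi' _ => m / 2
  | .eps => 0

/-- The multiplicity of `ζ ^ (n k) + ζ ^ (-n k)` in the restriction to the rotations. -/
def Irr.rotCoeff {m : ℕ} (χ : Irr m) : ℂ := if χ.idx = 0 ∨ 2 * χ.idx = m then 1 / 2 else 1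

/-- The sign of a linear character on the reflection `sr 0`; zero in the two-dimensional case. -/
def Irr.reflCoeff {m : ℕ} : Irr m → ℂ
  | .chi i => if i.val = 0 ∨ 2 * i.val = m then 1 else 0
  | .chi' _ => -1
  | .eps => -1

theorem Irr.two_mul_idx_le {m : ℕ} (χ : Irr m) : 2 * χ.idx ≤ m := by
  rcases χ with i | h | _
  · have := i.2
    simp only [Irr.idx]
    omega
  · simp only [Irr.idx]
    omega
  · simp [Irr.idx]

theorem Irr.rotCoeff_of_linear {m : ℕ} {χ : Irr m} (h : χ.idx = 0 ∨ 2 * χ.idx = m) :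
    χ.rotCoeff = 1 / 2 := if_pos h

theorem Irr.rotCoeff_of_not_linear {m : ℕ} {χ : Irr m} (h0 : χ.idx ≠ 0) (h2 : 2 * χ.idx ≠ m) :
    χ.rotCoeff = 1 := if_neg (by tauto)

/-- At index 0 or m/2 the two exponentials coincide, which accounts for the coefficient 1/2 of the
linear characters. This makes a case split on labels unnecessary in the Molien sums. -/
theorem Irr.char_r {m : ℕ} [NeZero m] (χ : Irr m) (k : ZMod m) :
    χ.char (.r k) = χ.rotCoeff * (zeta ((χ.idx : ZMod m) * k) + zeta (-((χ.idx : ZMod m) * k))) := by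
  have half : ∀ n : ℕ, 2 * n = m → (-1 : ℂ) ^ k.val = 
      1 / 2 * (zeta ((n : ZMod m) * k) + zeta (-((n : ZMod m) * k))) := by
    intro n hn
    have h : zeta (-((n : ZMod m) * k)) = zeta ((n : ZMod m) * k) := by
      congr 1
      rw [← sub_eq_zero, ← neg_mul, ← sub_mul, ← neg_add', ← Nat.cast_add, ← two_mul, hn]
      simp
    rw [neg_one_pow_val hn, h]
    ring
  rcases χ with i | h | _
  · by_cases h0 : i.val = 0
    · rw [Irr.rotCoeff_of_linear (χ := .chi i) (Or.inl h0)]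
      simp [Irr.char, Irr.idx, h0, zeta_zero]
      norm_num
    · by_cases h1 : 2 * i.val = m
      · rw [Irr.rotCoeff_of_linear (χ := .chi i) (Or.inr h1)]
        refine Eq.trans ?_ (half _ h1)
        simp [Irr.char, h0, h1]
      · rw [Irr.rotCoeff_of_not_linear (χ := .chi i) h0 h1, one_mul]
        simp [Irr.char, Irr.idx, h0, h1]
  · have h2 : 2 * (m / 2) = m := Nat.two_mul_div_two_of_even h
    rw [Irr.rotCoeff_of_linear (χ := .chi' h) (Or.inr h2)]
    exact half _ h2
  · rw [Irr.rotCoeff_of_linear (Or.inl rfl)]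
    simp [Irr.char, Irr.idx, zeta_zero]
    norm_num

theorem Irr.char_sr {m : ℕ} [NeZero m] (χ : Irr m) (k : ZMod m) :
    χ.char (.sr k) = χ.reflCoeff * zeta ((χ.idx : ZMod m) * k) := by
  rcases χ with i | h | _
  · simp only [Irr.char, Irr.reflCoeff, Irr.idx]
    split_ifs with h0 h1 h1 h2
    · simp [h0, zeta_zero]
    · omega
    · rw [neg_one_pow_val h1, one_mul]
    · omega
    · omega
    · simp
  · have h2 : 2 * (m / 2) = m := Nat.two_mul_div_two_of_even h
    simp only [Irr.char, Irr.reflCoeff, Irr.idx]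
    rw [neg_one_pow_val h2]
    ring
  · simp [Irr.char, Irr.reflCoeff, Irr.idx, zeta_zero]

theorem R_char {m : ℕ} [NeZero m] (χ : Irr m) :
    R χ.char = RatFunc.C χ.rotCoeff * palin (χ.idx : ZMod m) -
      (q ^ m - 1) / 2 * RatFunc.C (χ.reflCoeff * if (χ.idx : ZMod m) = 0 then 1 else 0) := by
  have hs : ∑ k, χ.char (.sr k) =
      m * (χ.reflCoeff * if (χ.idx : ZMod m) = 0 then 1 else 0) := by
    simp_rw [Irr.char_sr, ← Finset.mul_sum, sum_zeta_mul]
    split_ifs <;> ring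
  -- The general formula has two pairs of exponentials; the single pair is used twice, with half the
  -- coefficient.
  rw [R_of_rot (x := χ.idx) (y := χ.idx) (c := χ.rotCoeff / 2) _ hs]
  · congr 1
    rw [map_div₀, map_ofNat]
    ring
  · intro k
    rw [Irr.char_r]
    ring

/-- On rotations the product of two cosine characters splits into the pairs of index sum and index
difference. On reflections the product is one exponential, whose sum vanishes unless the indices add
to 0. -/
theorem Omega_apply {m : ℕ} [NeZero m] (χ ψ : Irr m) :
    Omega m χ ψ = q ^ m * (RatFunc.C (χ.rotCoeff * ψ.rotCoeff) *
      (palin ((χ.idx : ZMod m) + (ψ.idx : ZMod m)) + palin ((ψ.idx : ZMod m) - (χ.idx : ZMod m))) +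
      (q ^ m - 1) / 2 * RatFunc.C (χ.reflCoeff * ψ.reflCoeff *
        if ((χ.idx : ZMod m) + (ψ.idx : ZMod m)) = 0 then 1 else 0)) := by
  have hr : ∀ k : ZMod m, (reflRep m (.r k)).det = 1 := by
    intro k
    simp [reflRep, zeta_mul_zeta_neg]
  have hsr : ∀ k : ZMod m, (reflRep m (.sr k)).det = -1 := by
    intro k
    simp [reflRep, mul_comm, zeta_mul_zeta_neg]
  have hs : ∑ k, χ.char (.sr k) * ψ.char (.sr k) * star (reflRep m (.sr k)).det =
      m * -(χ.reflCoeff * ψ.reflCoeff * if ((χ.idx : ZMod m) + (ψ.idx : ZMod m)) = 0 then 1 else 0) := by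
    have : ∀ k : ZMod m, χ.char (.sr k) * ψ.char (.sr k) * star (reflRep m (.sr k)).det =
        -(χ.reflCoeff * ψ.reflCoeff) * zeta (((χ.idx : ZMod m) + (ψ.idx : ZMod m)) * k) := by
      intro k
      rw [Irr.char_sr, Irr.char_sr, hsr, add_mul, zeta_add]
      simp
      ring
    simp_rw [this, ← Finset.mul_sum, sum_zeta_mul]
    split_ifs <;> ring
  rw [Omega, R_of_rot (x := (χ.idx : ZMod m) + (ψ.idx : ZMod m))
    (y := (ψ.idx : ZMod m) - (χ.idx : ZMod m))
    (c := χ.rotCoeff * ψ.rotCoeff) _ hs, map_neg]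
  · ring
  · intro k
    rw [Irr.char_r, Irr.char_r, hr, add_mul, sub_mul, neg_add, neg_sub, sub_eq_add_neg,
      sub_eq_add_neg, zeta_add, zeta_add, zeta_add, zeta_add]
    simp
    ring

/-! ### Orders of vanishing, fake degrees and b-invariants -/

open Polynomial in
theorem ordZero_eq {f : K} {n : ℕ} {u v : ℂ[X]} (hu : u.eval 0 ≠ 0) (hv : v.eval 0 ≠ 0)
    (h : f * algebraMap ℂ[X] K v = q ^ n * algebraMap ℂ[X] K u) : ordZero f = n := by
  have ne_zero : ∀ {p : ℂ[X]}, p.eval 0 ≠ 0 → p ≠ 0 := by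
    rintro _ hp rfl
    simp at hp
  have trailing : ∀ {p : ℂ[X]}, p.eval 0 ≠ 0 → p.natTrailingDegree = 0 := by
    intro p hp
    rw [natTrailingDegree_eq_zero, coeff_zero_eq_eval_zero]
    exact Or.inr hp
  have hd : f.denom ≠ 0 := f.denom_ne_zero
  have hd' : algebraMap ℂ[X] K f.denom ≠ 0 := RatFunc.algebraMap_ne_zero hd
  have h1 : f.num * v = X ^ n * u * f.denom := by
    apply RatFunc.algebraMap_injective ℂ
    rw [← f.num_div_denom] at h
    simp only [map_mul, map_pow, RatFunc.algebraMap_X]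
    rw [div_mul_eq_mul_div, div_eq_iff hd'] at h
    exact h
  have hX : (X : ℂ[X]) ^ n ≠ 0 := pow_ne_zero n X_ne_zero
  have hn : f.num ≠ 0 := by
    intro h0
    rw [h0, zero_mul] at h1
    exact mul_ne_zero (mul_ne_zero hX (ne_zero hu)) hd h1.symm
  have h2 := congrArg natTrailingDegree h1
  rw [natTrailingDegree_mul hn (ne_zero hv), natTrailingDegree_mul (mul_ne_zero hX (ne_zero hu)) hd,
    natTrailingDegree_mul hX (ne_zero hu), natTrailingDegree_X_pow, trailing hu, trailing hv] at h2
  rw [ordZero]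
  omega

theorem C_half : RatFunc.C (1 / 2 : ℂ) = (1 / 2 : K) := by
  rw [map_div₀, map_one, map_ofNat]

theorem palin_zero {m : ℕ} [NeZero m] : palin (0 : ZMod m) = 1 + q ^ m := by
  simp [palin]

theorem natCast_zmod_eq_zero {m n : ℕ} (h : n < m) : (n : ZMod m) = 0 ↔ n = 0 := by
  rw [ZMod.natCast_eq_zero_iff]
  exact ⟨fun h' => Nat.eq_zero_of_dvd_of_lt h' h, by rintro rfl; exact dvd_zero m⟩

theorem Irr.idx_lt {m : ℕ} [NeZero m] (χ : Irr m) : χ.idx < m := by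
  have := χ.two_mul_idx_le
  have := NeZero.ne m
  omega

theorem R_chi_zero {m : ℕ} [NeZero m] : R (Irr.chi 0 : Irr m).char = 1 := by
  rw [R_char, Irr.rotCoeff_of_linear (Or.inl rfl), C_half]
  simp [Irr.idx, Irr.reflCoeff, palin_zero]
  ring

theorem R_eps {m : ℕ} [NeZero m] : R (Irr.eps : Irr m).char = q ^ m := by
  rw [R_char, Irr.rotCoeff_of_linear (Or.inl rfl), C_half]
  simp [Irr.idx, Irr.reflCoeff, palin_zero]
  ring

theorem R_of_idx_ne_zero {m : ℕ} [NeZero m] {χ : Irr m} (h : χ.idx ≠ 0) :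
    R χ.char = RatFunc.C χ.rotCoeff * (q ^ χ.idx + q ^ (m - χ.idx)) := by
  rw [R_char, if_neg ((natCast_zmod_eq_zero χ.idx_lt).not.2 h), palin_natCast χ.idx_lt.le]
  simp

theorem Irr.rotCoeff_ne_zero {m : ℕ} (χ : Irr m) : χ.rotCoeff ≠ 0 := by
  rw [Irr.rotCoeff]
  split_ifs <;> norm_num

/-- The bound on m ensures m/2 ≠ 0, which separates χ_r' from ε. -/
theorem Irr.ext_idx_reflCoeff {m : ℕ} (hm : 2 ≤ m) {χ ψ : Irr m} (h : χ.idx = ψ.idx)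
    (h' : χ.reflCoeff = ψ.reflCoeff) : χ = ψ := by
  have key : ∀ i : Fin (m / 2 + 1), (Irr.chi i : Irr m).reflCoeff ≠ -1 := by
    intro i
    simp only [Irr.reflCoeff]
    split_ifs <;> norm_num
  rcases χ with i | _ | _ <;> rcases ψ with j | _ | _
  · exact congrArg _ (Fin.ext h)
  · exact absurd h' (key i)
  · exact absurd h' (key i)
  · exact absurd h'.symm (key j)
  · rfl
  · simp only [Irr.idx] at h
    omega
  · exact absurd h'.symm (key j)
  · simp only [Irr.idx] at h
    omega
  · rfl

theorem Irr.reflCoeff_of_linear {m : ℕ} {χ : Irr m} (h : χ.idx = 0 ∨ 2 * χ.idx = m) :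
    χ.reflCoeff = 1 ∨ χ.reflCoeff = -1 := by
  rcases χ with i | _ | _
  · exact Or.inl (if_pos h)
  · exact Or.inr rfl
  · exact Or.inr rfl

theorem Irr.reflCoeff_of_not_linear {m : ℕ} {χ : Irr m} (h0 : χ.idx ≠ 0) (h2 : 2 * χ.idx ≠ m) :
    χ.reflCoeff = 0 := by
  rcases χ with i | h | _
  · exact if_neg (not_or.2 ⟨h0, h2⟩)
  · exact absurd (Nat.two_mul_div_two_of_even h) h2
  · exact absurd rfl h0

theorem Irr.eq_of_idx_eq_zero {m : ℕ} (hm : 2 ≤ m) {χ : Irr m} (h : χ.idx = 0) :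
    χ = .chi 0 ∨ χ = .eps := by
  rcases χ with i | h' | _
  · left
    congr 1
    exact Fin.ext h
  · simp only [Irr.idx] at h
    omega
  · right; rfl

theorem b_chi_zero {m : ℕ} [NeZero m] : b (Irr.chi 0 : Irr m) = 0 := by
  rw [b, R_chi_zero, ordZero_eq (n := 0) (u := 1) (v := 1) (by simp) (by simp) (by simp)]
  simp

theorem b_eps {m : ℕ} [NeZero m] : b (Irr.eps : Irr m) = m := by
  rw [b, R_eps, ordZero_eq (n := m) (u := 1) (v := 1) (by simp) (by simp) (by simp)]

theorem b_of_idx_ne_zero {m : ℕ} [NeZero m] {χ : Irr m} (h : χ.idx ≠ 0) : b χ = χ.idx := by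
  have h2 := χ.two_mul_idx_le
  rw [b, R_of_idx_ne_zero h, ordZero_eq (n := χ.idx) (v := 1)
    (u := Polynomial.C χ.rotCoeff * (1 + Polynomial.X ^ (m - 2 * χ.idx)))]
  · rw [Polynomial.eval_mul, Polynomial.eval_C]
    refine mul_ne_zero χ.rotCoeff_ne_zero ?_
    by_cases h3 : m - 2 * χ.idx = 0
    · rw [h3]
      simp
    · simp [h3]
  · simp
  · have h3 : m - χ.idx = χ.idx + (m - 2 * χ.idx) := by omega
    rw [h3, pow_add]
    simp only [map_mul, map_add, map_pow, map_one, RatFunc.algebraMap_X, RatFunc.algebraMap_C, q]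
    ring

theorem b_of_ne_eps {m : ℕ} [NeZero m] (hm : 2 ≤ m) {χ : Irr m} (h : χ ≠ .eps) :
    b χ = χ.idx := by
  by_cases h0 : χ.idx = 0
  · rcases Irr.eq_of_idx_eq_zero hm h0 with rfl | rfl
    · rw [b_chi_zero, h0, Nat.cast_zero]
    · exact absurd rfl h
  · exact b_of_idx_ne_zero h0

/-! ### Proportionality identities for `Omega` -/

theorem Omega_eps {m : ℕ} [NeZero m] (χ : Irr m) : Omega m χ .eps = q ^ m * R χ.char := by
  have h : (Irr.eps : Irr m).idx = 0 := rfl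
  have h' : (Irr.eps : Irr m).reflCoeff = -1 := rfl
  rw [Omega_apply, R_char, Irr.rotCoeff_of_linear (χ := .eps) (Or.inl h), map_mul, C_half, h, h',
    Nat.cast_zero, add_zero, zero_sub, palin_neg, mul_neg_one, neg_mul, map_neg]
  ring

theorem Omega_chi_zero {m : ℕ} [NeZero m] {χ : Irr m} (h : χ.idx ≠ 0) :
    Omega m (.chi 0) χ = q ^ m * R χ.char := by
  have h0 := (natCast_zmod_eq_zero χ.idx_lt).not.2 h
  have hi : (Irr.chi 0 : Irr m).idx = 0 := rfl
  rw [Omega_apply, R_char, Irr.rotCoeff_of_linear (χ := .chi 0) (Or.inl hi), map_mul, C_half, hi,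
    Nat.cast_zero, zero_add, sub_zero, if_neg h0, mul_zero, mul_zero, map_zero]
  ring

/-- With i ≤ j the two indices, the terms q^(2m-i-j) and q^(m+j-i) occur both in Ω and in the
product of fake degrees and cancel. What remains is q^i (q^m - 1) R(ψ), which is also the right-hand
side. -/
theorem Omega_sub_of_idx_le {m : ℕ} [NeZero m] {χ ψ : Irr m} (h0 : χ.idx ≠ 0)
    (h2 : 2 * χ.idx < m) (hle : χ.idx ≤ ψ.idx) :
    Omega m χ ψ - R χ.char * R ψ.char =
      q ^ χ.idx * (Omega m (.chi 0) ψ - R ψ.char) := by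
  have hψ : ψ.idx ≠ 0 := by omega
  have hψ2 := ψ.two_mul_idx_le
  have hc : χ.rotCoeff = 1 := if_neg (by omega)
  have hd : ((χ.idx : ZMod m) + (ψ.idx : ZMod m)) ≠ 0 := by
    rw [← Nat.cast_add, Ne, natCast_zmod_eq_zero] <;> omega
  rw [Omega_chi_zero hψ, R_of_idx_ne_zero h0, R_of_idx_ne_zero hψ, Omega_apply, if_neg hd,
    ← Nat.cast_add, ← Nat.cast_sub hle, palin_natCast (by omega), palin_natCast (by omega), hc]
  obtain ⟨j, hj⟩ := Nat.exists_eq_add_of_le hle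
  obtain ⟨n, hn⟩ := Nat.exists_eq_add_of_le hψ2
  have e1 : m - (χ.idx + ψ.idx) = j + n := by omega
  have e2 : ψ.idx - χ.idx = j := by omega
  have e3 : m - j = 2 * χ.idx + j + n := by omega
  have e4 : m - χ.idx = χ.idx + 2 * j + n := by omega
  have e5 : m - ψ.idx = χ.idx + j + n := by omega
  have e6 : m = 2 * χ.idx + 2 * j + n := by omega
  rw [e2, e1, e3, e4, e5, hj]
  have e7 : q ^ m = q ^ (2 * χ.idx + 2 * j + n) := by rw [← e6]
  rw [e7]
  simp
  ring

/-- Here R(χ) = q^(m/2) and the diagonal entry of Ω is q^(2m), so both sides are q^(2m) - q^m. -/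
theorem Omega_self_of_two_mul_idx {m : ℕ} [NeZero m] {χ : Irr m} (h : 2 * χ.idx = m) :
    Omega m χ χ - R χ.char * R χ.char = q ^ χ.idx * (Omega m (.chi 0) χ - R χ.char) := by
  have h0 : χ.idx ≠ 0 := by have := NeZero.ne m; omega
  have hc : χ.rotCoeff = 1 / 2 := if_pos (Or.inr h)
  have hd : χ.reflCoeff * χ.reflCoeff = 1 := by
    rcases Irr.reflCoeff_of_linear (Or.inr h) with e | e <;> rw [e] <;> ring
  have hz : ((χ.idx : ZMod m) + (χ.idx : ZMod m)) = 0 := by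
    rw [← Nat.cast_add, ← two_mul, h, CharP.cast_eq_zero]
  rw [Omega_chi_zero h0, R_of_idx_ne_zero h0, Omega_apply, hz, if_pos rfl, sub_self, palin_zero,
    hc, hd]
  have e1 : m - χ.idx = χ.idx := by omega
  have e2 : q ^ m = q ^ (2 * χ.idx) := by rw [h]
  rw [e1, e2, map_mul, C_half]
  simp only [mul_one, map_one]
  ring

/-- The opposite signs on reflections reduce the entry of Ω to q^m, the product of the two fake
degrees. This is where proportionality with the row of χ_0 fails. -/
theorem Omega_of_two_mul_idx {m : ℕ} [NeZero m] (hm : 2 ≤ m) {χ ψ : Irr m}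
    (h : 2 * χ.idx = m)
    (h' : 2 * ψ.idx = m) (hne : χ ≠ ψ) : Omega m χ ψ - R χ.char * R ψ.char = 0 := by
  have h0 : χ.idx ≠ 0 := by have := NeZero.ne m; omega
  have h0' : ψ.idx ≠ 0 := by have := NeZero.ne m; omega
  have hc : χ.rotCoeff = 1 / 2 := if_pos (Or.inr h)
  have hc' : ψ.rotCoeff = 1 / 2 := if_pos (Or.inr h')
  have hi : ψ.idx = χ.idx := by omega
  have hd : χ.reflCoeff * ψ.reflCoeff = -1 := by
    have hne' : χ.reflCoeff ≠ ψ.reflCoeff := fun h => hne (Irr.ext_idx_reflCoeff hm hi.symm h)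
    rcases Irr.reflCoeff_of_linear (Or.inr h) with e | e <;>
      rcases Irr.reflCoeff_of_linear (Or.inr h') with e' | e' <;> rw [e, e'] at hne' ⊢ <;>
      first | exact absurd rfl hne' | ring
  have hz : ((χ.idx : ZMod m) + (χ.idx : ZMod m)) = 0 := by
    rw [← Nat.cast_add, ← two_mul, h, CharP.cast_eq_zero]
  rw [R_of_idx_ne_zero h0, R_of_idx_ne_zero h0', Omega_apply, hi, hz, if_pos rfl, sub_self,
    palin_zero, hc, hc', hd]
  have e1 : m - χ.idx = χ.idx := by omega
  have e2 : q ^ m = q ^ (2 * χ.idx) := by rw [h]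
  rw [e1, e2, map_mul, C_half]
  simp only [mul_one, map_one, map_neg]
  ring

/-! ### Nondegeneracy of `Omega` -/

/-- Tensoring with the sign character. -/
def Irr.twist {m : ℕ} : Irr m → Irr m
  | .chi i => if i.val = 0 then .eps
      else if h : 2 * i.val = m then .chi' ⟨i.val, by omega⟩ else .chi i
  | .chi' _ => .chi (Fin.last _)
  | .eps => .chi 0

theorem Irr.idx_twist {m : ℕ} (χ : Irr m) : χ.twist.idx = χ.idx := by
  rcases χ with i | h | _
  · by_cases h0 : i.val = 0
    · simp [Irr.twist, Irr.idx, h0]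
    · by_cases h2 : 2 * i.val = m
      · simp only [Irr.twist, h0, h2, if_false, dite_true, Irr.idx]
        omega
      · simp [Irr.twist, h0, h2]
  · simp [Irr.twist, Irr.idx]
  · simp [Irr.twist, Irr.idx]

theorem Irr.reflCoeff_twist {m : ℕ} (χ : Irr m) : χ.twist.reflCoeff = -χ.reflCoeff := by
  rcases χ with i | h | _
  · by_cases h0 : i.val = 0
    · simp [Irr.twist, Irr.reflCoeff, h0]
    · by_cases h2 : 2 * i.val = m
      · simp [Irr.twist, Irr.reflCoeff, h0, h2]
      · have h0' : i ≠ 0 := by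
          rintro rfl
          exact h0 rfl
        simp [Irr.twist, Irr.reflCoeff, h0', h2]
  · simp [Irr.twist, Irr.reflCoeff, Nat.two_mul_div_two_of_even h]
  · simp [Irr.twist, Irr.reflCoeff]

theorem Irr.twist_twist {m : ℕ} (hm : 2 ≤ m) (χ : Irr m) : χ.twist.twist = χ := by
  apply Irr.ext_idx_reflCoeff hm
  · rw [Irr.idx_twist, Irr.idx_twist]
  · rw [Irr.reflCoeff_twist, Irr.reflCoeff_twist, neg_neg]

-- At q = 0 the fake degree of f becomes its inner product with the trivial character, so the left
-- side is the constant term of Ω/q^m. It is Schur orthogonality for χ ⊗ ψ against the sign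
-- character.
open Classical in
theorem rotCoeff_reflCoeff_orthogonality {m : ℕ} [NeZero m] (hm : 2 ≤ m) (χ ψ : Irr m) :
    χ.rotCoeff * ψ.rotCoeff *
      ((if (χ.idx : ZMod m) + (ψ.idx : ZMod m) = 0 then 1 else 0) +
        (if (ψ.idx : ZMod m) - (χ.idx : ZMod m) = 0 then 1 else 0)) -
      1 / 2 * (χ.reflCoeff * ψ.reflCoeff *
        if (χ.idx : ZMod m) + (ψ.idx : ZMod m) = 0 then 1 else 0) =
      if ψ = χ.twist then 1 else 0 := by
  have hχ := χ.two_mul_idx_le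
  have hψ := ψ.two_mul_idx_le
  have h1 : ((χ.idx : ZMod m) + (ψ.idx : ZMod m) = 0) ↔
      χ.idx = ψ.idx ∧ (χ.idx = 0 ∨ 2 * χ.idx = m) := by
    rw [← Nat.cast_add, ZMod.natCast_eq_zero_iff]
    constructor
    · intro h
      rcases Nat.eq_zero_or_pos (χ.idx + ψ.idx) with h0 | h0
      · omega
      · have := Nat.le_of_dvd h0 h
        omega
    · rintro ⟨h, h' | h'⟩
      · rw [← h, h']; simp
      · rw [← h, ← two_mul, h']
  have h2 : ((ψ.idx : ZMod m) - (χ.idx : ZMod m) = 0) ↔ χ.idx = ψ.idx := by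
    rw [sub_eq_zero]
    constructor
    · intro h
      have := congrArg ZMod.val h
      rwa [ZMod.val_cast_of_lt χ.idx_lt, ZMod.val_cast_of_lt ψ.idx_lt, eq_comm] at this
    · intro h
      rw [h]
  simp only [h1, h2]
  by_cases hi : χ.idx = ψ.idx
  · by_cases hl : χ.idx = 0 ∨ 2 * χ.idx = m
    · have hl' := hl
      rw [hi] at hl'
      rw [Irr.rotCoeff_of_linear hl, Irr.rotCoeff_of_linear hl', if_pos ⟨hi, hl⟩, if_pos hi]
      by_cases ht : ψ = χ.twist
      · have hd : χ.reflCoeff * ψ.reflCoeff = -1 := by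
          rw [ht, Irr.reflCoeff_twist]
          rcases Irr.reflCoeff_of_linear hl with h | h <;> rw [h] <;> norm_num
        rw [if_pos ht, hd]
        norm_num
      · have hne : ψ.reflCoeff ≠ -χ.reflCoeff := by
          intro h
          apply ht
          apply Irr.ext_idx_reflCoeff hm
          · rw [Irr.idx_twist, hi]
          · rw [Irr.reflCoeff_twist, h]
        have hd : χ.reflCoeff * ψ.reflCoeff = 1 := by
          rcases Irr.reflCoeff_of_linear hl with h | h <;>
            rcases Irr.reflCoeff_of_linear hl' with h' | h' <;> rw [h, h'] at hne ⊢ <;>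
            first | exact absurd rfl hne | exact absurd (neg_neg _).symm hne | norm_num
        rw [if_neg ht, hd]
        norm_num
    · have h0 := (not_or.1 hl).1
      have h2 := (not_or.1 hl).2
      have ht : ψ = χ.twist := by
        apply Irr.ext_idx_reflCoeff hm
        · rw [Irr.idx_twist, hi]
        · rw [Irr.reflCoeff_twist, Irr.reflCoeff_of_not_linear h0 h2,
            Irr.reflCoeff_of_not_linear (hi ▸ h0) (hi ▸ h2), neg_zero]
      rw [Irr.rotCoeff_of_not_linear h0 h2, Irr.rotCoeff_of_not_linear (hi ▸ h0) (hi ▸ h2),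
        if_neg (fun h => hl h.2), if_pos hi, if_pos ht]
      norm_num
  · have ht : ψ ≠ χ.twist := by
      rintro rfl
      exact hi (Irr.idx_twist χ).symm
    rw [if_neg (fun h => hi h.1), if_neg hi, if_neg ht]
    norm_num

-- After the factor q^m is removed, Ω has polynomial entries, and at q = 0 it becomes the
-- permutation matrix of the involution `Irr.twist`, which is invertible.
open Classical in
theorem det_Omega_ne_zero {m : ℕ} [NeZero m] (hm : 2 ≤ m) : (Omega m).det ≠ 0 := by
  let p : ZMod m → Polynomial ℂ := fun x => Polynomial.X ^ x.val + Polynomial.X ^ (m - x.val)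
  let A : Matrix (Irr m) (Irr m) (Polynomial ℂ) := fun χ ψ =>
    Polynomial.C (χ.rotCoeff * ψ.rotCoeff) *
      (p ((χ.idx : ZMod m) + (ψ.idx : ZMod m)) + p ((ψ.idx : ZMod m) - (χ.idx : ZMod m))) +
      (Polynomial.X ^ m - 1) * Polynomial.C (1 / 2 * (χ.reflCoeff * ψ.reflCoeff *
        if (χ.idx : ZMod m) + (ψ.idx : ZMod m) = 0 then 1 else 0))
  have hp : ∀ x, algebraMap (Polynomial ℂ) K (p x) = palin x := by
    intro x
    simp [p, palin, q]
  have hA : Omega m = q ^ m • (algebraMap (Polynomial ℂ) K).mapMatrix A := by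
    ext χ ψ
    change _ = q ^ m * algebraMap (Polynomial ℂ) K (A χ ψ)
    simp only [Omega_apply, A, map_add, map_mul, hp, map_sub, map_pow, map_one,
      RatFunc.algebraMap_X, RatFunc.algebraMap_C, C_half, q]
    ring
  have hp0 : ∀ x, (p x).eval 0 = if x = 0 then 1 else 0 := by
    intro x
    have hx := x.val_lt
    have : m - x.val ≠ 0 := by omega
    by_cases h : x = 0
    · simp [p, h, NeZero.ne m]
    · have : x.val ≠ 0 := by rwa [Ne, ZMod.val_eq_zero]
      simp [p, *]
  let B : Matrix (Irr m) (Irr m) ℂ := Matrix.of fun χ ψ => if ψ = χ.twist then 1 else 0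
  have hB : (Polynomial.evalRingHom (0 : ℂ)).mapMatrix A = B := by
    ext χ ψ
    change Polynomial.eval 0 (A χ ψ) = if ψ = χ.twist then 1 else 0
    rw [← rotCoeff_reflCoeff_orthogonality hm]
    simp only [A, Polynomial.eval_add, Polynomial.eval_mul, Polynomial.eval_C, hp0,
      Polynomial.eval_sub, Polynomial.eval_pow, Polynomial.eval_X, Polynomial.eval_one,
      zero_pow (NeZero.ne m)]
    ring
  have hBB : B * B = 1 := by
    ext χ ψ
    rw [Matrix.mul_apply, Matrix.one_apply, Finset.sum_eq_single χ.twist]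
    · simp [B, Irr.twist_twist hm, eq_comm]
    · intro φ _ hφ
      simp [B, hφ]
    · simp
  have hdet : A.det ≠ 0 := by
    intro h
    have h1 := congrArg Matrix.det hBB
    rw [Matrix.det_mul, ← hB, ← RingHom.map_det, h, map_zero, zero_mul, Matrix.det_one] at h1
    exact zero_ne_one h1
  rw [hA, Matrix.det_smul, ← RingHom.map_det]
  exact mul_ne_zero (pow_ne_zero _ (pow_ne_zero _ q_ne_zero)) (RatFunc.algebraMap_ne_zero hdet)

/-! ### Reduced words -/

theorem length_altWord (x : Bool) (n : ℕ) : (altWord x n).length = n := by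
  induction n generalizing x with
  | zero => rfl
  | succ n ih => simp [altWord, ih]

theorem prod_altWord_even {M : Type} [Monoid M] (f : Bool → M) (x : Bool) (n : ℕ) :
    ((altWord x (2 * n)).map f).prod = (f x * f (!x)) ^ n := by
  induction n with
  | zero => simp [altWord]
  | succ n ih =>
    rw [mul_add, mul_one, altWord, altWord, List.map_cons, List.map_cons, List.prod_cons,
      List.prod_cons, Bool.not_not, ih, pow_succ', mul_assoc]

theorem prod_altWord_odd {M : Type} [Monoid M] (f : Bool → M) (x : Bool) (n : ℕ) :
    ((altWord x (2 * n + 1)).map f).prod = (f x * f (!x)) ^ n * f x := by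
  induction n with
  | zero => simp [altWord]
  | succ n ih =>
    rw [mul_add, mul_one, add_right_comm, altWord, altWord, List.map_cons, List.map_cons,
      List.prod_cons, List.prod_cons, Bool.not_not, ih, pow_succ']
    simp only [mul_assoc]

theorem redWord_r {m : ℕ} [NeZero m] (k : ZMod m) : ∃ n x y, 2 * n ≤ m ∧
    redWord (.r k) = altWord x (2 * n) ∧ redWord (.r (-k)) = altWord y (2 * n) := by
  have hk := k.val_lt
  have hneg := ZMod.neg_val k
  simp only [redWord, neg_neg]
  rcases lt_trichotomy k.val (-k).val with h | h | h
  · refine ⟨k.val, true, false, ?_, ?_, ?_⟩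
    · split_ifs at hneg <;> omega
    · rw [if_pos h.le]
    · rw [if_neg h.not_ge]
  · refine ⟨k.val, true, true, ?_, ?_, ?_⟩
    · split_ifs at hneg with h0
      · rw [h0, ZMod.val_zero]
        omega
      · omega
    · rw [if_pos h.le]
    · rw [if_pos h.ge, h]
  · refine ⟨(-k).val, false, true, ?_, ?_, ?_⟩
    · split_ifs at hneg <;> omega
    · rw [if_neg h.not_ge]
    · rw [if_pos h.le]

theorem redWord_sr {m : ℕ} [NeZero m] (k : ZMod m) : ∃ n x, 2 * n + 1 ≤ m ∧
    redWord (.sr k) = altWord x (2 * n + 1) := by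
  have hm := NeZero.ne m
  have hk := k.val_lt
  have hneg := ZMod.neg_val k
  simp only [redWord]
  by_cases h0 : k = 0
  · refine ⟨0, true, by omega, ?_⟩
    simp [h0]
  · rw [if_neg h0] at hneg
    by_cases h : (-k).val < k.val
    · refine ⟨(-k).val, true, by omega, ?_⟩
      rw [if_pos (Or.inr h)]
    · have h1 : k.val ≠ 0 := by rwa [Ne, ZMod.val_eq_zero]
      refine ⟨k.val - 1, false, by omega, ?_⟩
      rw [if_neg (by tauto)]
      congr 1
      omega

theorem redWord_sr_zero {m : ℕ} [NeZero m] :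
    redWord (.sr 0 : DihedralGroup m) = altWord true 1 := by
  simp [redWord]

theorem redWord_sr_one {m : ℕ} [NeZero m] (hm : 3 ≤ m) :
    redWord (.sr 1 : DihedralGroup m) = altWord false 1 := by
  have : Fact (1 < m) := ⟨by omega⟩
  have h1 : (1 : ZMod m).val = 1 := ZMod.val_one m
  have hneg := ZMod.neg_val (1 : ZMod m)
  have h0 : (1 : ZMod m) ≠ 0 := one_ne_zero
  rw [if_neg h0, h1] at hneg
  have : ¬((1 : ZMod m) = 0 ∨ (-1 : ZMod m).val < (1 : ZMod m).val) := by
    rw [h1, hneg]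
    rintro (h | h)
    · exact h0 h
    · omega
  simp only [redWord]
  rw [if_neg this, h1]

/-- The longest element: a rotation for m even, a reflection for m odd. It supplies the lowest power
of q in the Schur element of the sign character. -/
theorem exists_len_eq {m : ℕ} [NeZero m] : ∃ w : DihedralGroup m, len w = m := by
  have hm := NeZero.ne m
  rcases Nat.even_or_odd' m with ⟨n, hn | hn⟩
  · refine ⟨.r (n : ZMod m), ?_⟩
    have h1 : (n : ZMod m).val = n := ZMod.val_cast_of_lt (by omega)
    have h2 := ZMod.neg_val (n : ZMod m)
    rw [if_neg (by rw [← ZMod.val_eq_zero]; omega), h1] at h2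
    simp only [len, redWord]
    rw [if_pos (by omega), length_altWord]
    omega
  · by_cases h0 : n = 0
    · refine ⟨.sr 0, ?_⟩
      rw [len, redWord_sr_zero, length_altWord]
      omega
    · refine ⟨.sr ((n + 1 : ℕ) : ZMod m), ?_⟩
      have h1 : ((n + 1 : ℕ) : ZMod m).val = n + 1 := ZMod.val_cast_of_lt (by omega)
      have h2 := ZMod.neg_val ((n + 1 : ℕ) : ZMod m)
      rw [if_neg (by rw [← ZMod.val_eq_zero]; omega), h1] at h2
      simp only [len, redWord]
      rw [if_pos (Or.inr (by omega)), length_altWord]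
      omega

/-! ### Schur elements, generic degrees and special characters -/

open Polynomial in
theorem poincare_eq {m : ℕ} :
    poincare m = algebraMap ℂ[X] K ((1 + X) * ∑ l ∈ Finset.range m, X ^ l) := by
  have h1 : q - 1 ≠ 0 := by simpa using q_pow_sub_one_ne_zero one_pos
  have h2 : q ≠ 1 := sub_ne_zero.1 h1
  simp only [map_mul, map_add, map_one, map_sum, map_pow, RatFunc.algebraMap_X]
  change _ = (1 + q) * ∑ l ∈ Finset.range m, q ^ l
  rw [geom_sum_eq h2, poincare]
  field_simp
  ring

open Polynomial in
/-- If every summand of the Schur element is, up to `q ^ a`, a polynomial with nonnegative constant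
term, then the generic degree is divisible by exactly `q ^ a`. -/
theorem ordZero_genericDegree {m : ℕ} [NeZero m] {χ : Irr m} (a : ℕ) {d : ℂ} (hd : d ≠ 0)
    (h1 : heckeChar χ 1 = RatFunc.C d) (w₀ : DihedralGroup m)
    (h : ∀ w, ∃ (p : ℂ[X]) (c : ℝ), 0 ≤ c ∧ (w = w₀ → 0 < c) ∧ p.eval 0 = c ∧
      q ^ a * ((q ^ len w)⁻¹ * heckeChar χ w * heckeChar χ w⁻¹) = algebraMap ℂ[X] K p) :
    ordZero (genericDegree χ) = a := by
  choose p c hc hc₀ hp heq using h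
  have hsum : (∑ w, p w).eval 0 ≠ 0 := by
    rw [eval_finsetSum, Finset.sum_congr rfl fun w _ => hp w, ← Complex.ofReal_sum,
      Complex.ofReal_ne_zero]
    -- Nonnegativity rules out cancellation among the constant terms, so the single positive one at
    -- w₀ suffices.
    exact (Finset.sum_pos' (fun w _ => hc w) ⟨w₀, Finset.mem_univ _, hc₀ w₀ rfl⟩).ne'
  have hne : algebraMap ℂ[X] K (∑ w, p w) ≠ 0 := by
    apply RatFunc.algebraMap_ne_zero
    intro h0
    simp [h0] at hsum
  have hd' : RatFunc.C d ≠ 0 := by simpa using hd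
  have hschur : schurElt χ = algebraMap ℂ[X] K (∑ w, p w) / (q ^ a * RatFunc.C d) := by
    rw [schurElt, h1, map_sum, ← Finset.sum_congr rfl fun w _ => heq w, ← Finset.mul_sum,
      mul_div_mul_left _ _ (pow_ne_zero a q_ne_zero)]
  apply ordZero_eq (u := (1 + X) * ∑ l ∈ Finset.range m, X ^ l * C d) (v := ∑ w, p w) _ hsum
  · rw [genericDegree, hschur, poincare_eq]
    simp only [← Finset.sum_mul, map_mul, RatFunc.algebraMap_C]
    have := pow_ne_zero a q_ne_zero
    field_simp
  · obtain ⟨n, rfl⟩ := Nat.exists_eq_succ_of_ne_zero (NeZero.ne m)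
    rw [← Finset.sum_mul, Finset.sum_range_succ', eval_mul, eval_mul, eval_add (p := ∑ _ ∈ _, _),
      eval_finsetSum]
    simpa using hd

theorem len_eq_of_redWord {m : ℕ} {w : DihedralGroup m} {x : Bool} {n : ℕ}
    (h : redWord w = altWord x n) : len w = n := by
  rw [len, h, length_altWord]

theorem evalWord_one {M : Type} [Monoid M] {m : ℕ} [NeZero m] (S T : M) :
    evalWord S T (1 : DihedralGroup m) = 1 := by
  rw [DihedralGroup.one_def, evalWord]
  simp [redWord, altWord]

theorem evalWord_mul_inv_r {F : Type} [Field F] {m : ℕ} [NeZero m] (x y : F) (k : ZMod m) :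
    ∃ n, 2 * n ≤ m ∧ len (.r k : DihedralGroup m) = 2 * n ∧
      evalWord x y (.r k : DihedralGroup m) * evalWord x y (.r k : DihedralGroup m)⁻¹ =
        (x * y) ^ (2 * n) := by
  obtain ⟨n, u, v, hn, h1, h2⟩ := redWord_r k
  refine ⟨n, hn, len_eq_of_redWord h1, ?_⟩
  rw [DihedralGroup.inv_r, evalWord, evalWord, h1, h2, prod_altWord_even, prod_altWord_even]
  cases u <;> cases v <;> simp <;> ring

theorem evalWord_mul_inv_sr {F : Type} [Field F] {m : ℕ} [NeZero m] (x y : F) (k : ZMod m) :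
    ∃ n u, 2 * n + 1 ≤ m ∧ redWord (.sr k : DihedralGroup m) = altWord u (2 * n + 1) ∧
      evalWord x y (.sr k : DihedralGroup m) * evalWord x y (.sr k : DihedralGroup m)⁻¹ =
        (x * y) ^ (2 * n) * (if u then x else y) ^ 2 := by
  obtain ⟨n, u, hn, h1⟩ := redWord_sr k
  refine ⟨n, u, hn, h1, ?_⟩
  rw [DihedralGroup.inv_sr, evalWord, h1, prod_altWord_odd]
  cases u <;> simp <;> ring

theorem altWord_odd_inj {x y : Bool} {n : ℕ} (h : altWord x (2 * n + 1) = altWord y 1) :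
    x = y ∧ n = 0 := by
  have h1 := congrArg List.length h
  rw [length_altWord, length_altWord] at h1
  have h2 : n = 0 := by omega
  subst h2
  simpa [altWord] using h

open Polynomial in
theorem ordZero_genericDegree_trivial {m : ℕ} [NeZero m] :
    ordZero (genericDegree (.chi 0 : Irr m)) = 0 := by
  have hχ : ∀ w, heckeChar (.chi 0 : Irr m) w = evalWord q q w := fun w => by
    cases w <;> simp [heckeChar]
  have hq := q_ne_zero
  refine ordZero_genericDegree 0 one_ne_zero ?_ 1 ?_
  · rw [hχ, evalWord_one, map_one]
  · rintro (k | k)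
    · obtain ⟨n, -, hlen, h⟩ := evalWord_mul_inv_r q q k
      refine ⟨X ^ (2 * n), 0 ^ (2 * n), by positivity, ?_, by simp, ?_⟩
      · intro hk
        rw [hk, DihedralGroup.one_def] at hlen
        have : n = 0 := by simpa [len, redWord, altWord] using hlen.symm
        simp [this]
      · rw [hχ, hχ, mul_assoc, h, hlen]
        simp only [map_pow, RatFunc.algebraMap_X]
        change _ = q ^ (2 * n)
        field_simp
        ring
    · obtain ⟨n, u, -, hred, h⟩ := evalWord_mul_inv_sr q q k
      refine ⟨X ^ (2 * n + 1), 0, le_rfl, ?_, by simp, ?_⟩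
      · intro hk
        rw [DihedralGroup.one_def] at hk
        cases hk
      · rw [hχ, hχ, mul_assoc, h, len_eq_of_redWord hred, ite_self]
        simp only [map_pow, RatFunc.algebraMap_X]
        change _ = q ^ (2 * n + 1)
        field_simp
        ring

open Polynomial in
theorem ordZero_genericDegree_sign {m : ℕ} [NeZero m] :
    ordZero (genericDegree (.eps : Irr m)) = m := by
  have hχ : ∀ w, heckeChar (.eps : Irr m) w = evalWord (-1) (-1) w := fun w => rfl
  have hq := q_ne_zero
  obtain ⟨w₀, hw₀⟩ := exists_len_eq (m := m)
  have main : ∀ w : DihedralGroup m, len w ≤ m →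
      heckeChar .eps w * heckeChar .eps w⁻¹ = 1 → ∃ (p : ℂ[X]) (c : ℝ), 0 ≤ c ∧ (w = w₀ → 0 < c) ∧
      p.eval 0 = c ∧ q ^ m * ((q ^ len w)⁻¹ * heckeChar .eps w * heckeChar .eps w⁻¹) =
        algebraMap ℂ[X] K p := by
    intro w hw h
    refine ⟨X ^ (m - len w), 0 ^ (m - len w), by positivity, ?_, by simp, ?_⟩
    · rintro rfl
      simp [hw₀]
    · rw [mul_assoc, h, mul_one, map_pow, RatFunc.algebraMap_X]
      exact (pow_sub₀ q hq hw).symm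
  refine ordZero_genericDegree m one_ne_zero ?_ w₀ ?_
  · rw [hχ, evalWord_one, map_one]
  · rintro (k | k)
    · obtain ⟨n, hn, hlen, h⟩ := evalWord_mul_inv_r (-1 : K) (-1) k
      exact main _ (by omega) (by rw [hχ, hχ, h]; simp)
    · obtain ⟨n, u, hn, hred, h⟩ := evalWord_mul_inv_sr (-1 : K) (-1) k
      exact main _ (by rw [len_eq_of_redWord hred]; exact hn) (by rw [hχ, hχ, h]; simp)

open Polynomial in
/-- The linear characters of the Hecke algebra that take both values `q` and `-1` on the
generators. -/
theorem ordZero_genericDegree_mixed {m : ℕ} [NeZero m] {χ : Irr m} {x y : K}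
    (hχ : ∀ w, heckeChar χ w = evalWord x y w) (v : Bool)
    (h₁ : (if v then x else y) = -1) (h₂ : (if v then y else x) = q) {k₀ : ZMod m}
    (hk₀ : redWord (.sr k₀) = altWord v 1) : ordZero (genericDegree χ) = 1 := by
  have hq := q_ne_zero
  have hxy : x * y = -q := by
    cases v <;> simp at h₁ h₂ <;> rw [h₁, h₂] <;> ring
  -- The witness is the simple reflection whose generator acts by -1. After multiplication by q,
  -- rotations contribute q, and reflections contribute 1 or q² according to the first letter of
  -- their word.
  refine ordZero_genericDegree 1 one_ne_zero ?_ (.sr k₀) ?_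
  · rw [hχ, evalWord_one, map_one]
  · rintro (k | k)
    · obtain ⟨n, -, hlen, h⟩ := evalWord_mul_inv_r x y k
      refine ⟨X, 0, le_rfl, by simp, by simp, ?_⟩
      rw [hχ, hχ, mul_assoc, h, hlen, RatFunc.algebraMap_X, hxy, pow_mul (-q), neg_sq, ← pow_mul]
      change _ = q
      field_simp
    · obtain ⟨n, u, -, hred, h⟩ := evalWord_mul_inv_sr x y k
      rw [hχ, hχ, mul_assoc, h, len_eq_of_redWord hred, hxy, pow_mul (-q), neg_sq, ← pow_mul]
      by_cases huv : u = v
      · refine ⟨1, 1, zero_le_one, by simp, by simp, ?_⟩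
        rw [huv, h₁, map_one]
        field_simp
        ring
      · refine ⟨X ^ 2, 0, le_rfl, ?_, by simp, ?_⟩
        · intro hk
          rw [← hk, hred] at hk₀
          exact absurd (altWord_odd_inj hk₀).1 huv
        · have : (if u then x else y) = q := by
            rw [← h₂]
            cases u <;> cases v <;> simp at huv ⊢
          rw [this, map_pow, RatFunc.algebraMap_X]
          change _ = q ^ 2
          field_simp
          ring

/-- The sequence with `a (n + 2) = t a (n + 1) - a n` and given first two terms. -/
def chebyshevSeq (t a₀ a₁ : ℝ) : ℕ → ℝ
  | 0 => a₀
  | 1 => a₁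
  | n + 2 => t * chebyshevSeq t a₀ a₁ (n + 1) - chebyshevSeq t a₀ a₁ n

/-- The quadratic relation for A gives a two-step recurrence for the traces; once q^n is scaled out,
its coefficients are real constants. -/
theorem trace_pow_mul {A B : Matrix (Fin 2) (Fin 2) K} {t a₀ a₁ : ℝ} {x : K}
    (hA : A * A = (q * RatFunc.C (t : ℂ)) • A - q ^ 2 • (1 : Matrix (Fin 2) (Fin 2) K))
    (h₀ : B.trace = x * RatFunc.C (a₀ : ℂ)) (h₁ : (A * B).trace = q * x * RatFunc.C (a₁ : ℂ))
    (n : ℕ) : (A ^ n * B).trace = q ^ n * x * RatFunc.C (chebyshevSeq t a₀ a₁ n : ℂ) := by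
  induction n using Nat.twoStepInduction with
  | zero => simpa [chebyshevSeq] using h₀
  | one => simpa [chebyshevSeq] using h₁
  | more n ih ih' =>
    have h : A ^ (n + 2) * B = (q * RatFunc.C (t : ℂ)) • (A ^ (n + 1) * B) - q ^ 2 • (A ^ n * B) := by
      rw [pow_add, pow_two, hA, mul_sub, sub_mul, pow_succ A n]
      simp
    rw [h, Matrix.trace_sub, Matrix.trace_smul, Matrix.trace_smul, ih, ih', chebyshevSeq]
    simp only [smul_eq_mul, Complex.ofReal_sub, Complex.ofReal_mul, map_sub, map_mul]
    ring

theorem exists_real_zeta_add {m : ℕ} [NeZero m] (k : ZMod m) :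
    ∃ t : ℝ, zeta k + zeta (-k) = t := by
  refine ⟨2 * (zeta k).re, ?_⟩
  have h : zeta (-k) = (starRingEnd ℂ) (zeta k) := AddChar.map_neg_eq_conj _ k
  rw [h, Complex.add_conj]

-- The product of the two generators has trace qt and determinant q², so traces on words are a power
-- of q times a real constant c, with an extra factor q - 1 for words of odd length. After
-- multiplication by q, rotations contribute q c² and reflections (q - 1)² c²; since t is real, the
-- constant terms are nonnegative, and c = 1 at the reflection `sr 0`.
open Polynomial in
theorem ordZero_genericDegree_two_dim {m : ℕ} [NeZero m] {i : Fin (m / 2 + 1)}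
    (h0 : i.val ≠ 0) (h2 : 2 * i.val ≠ m) : ordZero (genericDegree (.chi i : Irr m)) = 1 := by
  have hq := q_ne_zero
  obtain ⟨t, ht⟩ := exists_real_zeta_add (i.val : ZMod m)
  have hC2 : RatFunc.C (2 : ℂ) = 2 := map_ofNat _ 2
  let g : Bool → Matrix (Fin 2) (Fin 2) K := fun x =>
    if x then !![-1, 0; 1, q] else !![q, q * (2 + RatFunc.C (t : ℂ)); 0, -1]
  have hχ : ∀ w, heckeChar (.chi i : Irr m) w = ((redWord w).map g).prod.trace := by
    intro w
    have h : heckeChar (.chi i : Irr m) w = (evalWord !![-1, 0; 1, q]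
        !![q, q * RatFunc.C (2 + zeta (i.val : ZMod m) + zeta (-(i.val : ZMod m))); 0, -1]
        w).trace := by
      simp only [heckeChar, if_neg h0, if_neg h2]
    rw [h, add_assoc, ht, map_add, hC2]
    rfl
  have htr : ∀ x, (g x).trace = (q - 1) * RatFunc.C ((1 : ℝ) : ℂ) := by
    intro x
    cases x <;> simp [g, Matrix.trace_fin_two] <;> ring
  have htr' : ∀ x, (g x * g (!x) * g x).trace = q * (q - 1) * RatFunc.C ((1 + t : ℝ) : ℂ) := by
    intro x
    cases x <;> simp [g, Matrix.trace_fin_two] <;> ring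
  have htr'' : ∀ x, (g x * g (!x)).trace = q * 1 * RatFunc.C (t : ℂ) := by
    intro x
    cases x <;> simp [g, Matrix.trace_fin_two] <;> ring
  have hsq : ∀ x, g x * g (!x) * (g x * g (!x)) = (q * RatFunc.C (t : ℂ)) • (g x * g (!x)) -
      q ^ 2 • (1 : Matrix (Fin 2) (Fin 2) K) := by
    intro x
    ext a b
    cases x <;> fin_cases a <;> fin_cases b <;> simp [g, Matrix.mul_apply] <;> ring
  have hrot : ∀ x n, ((altWord x (2 * n)).map g).prod.trace =
      q ^ n * 1 * RatFunc.C (chebyshevSeq t 2 t n : ℂ) := by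
    intro x n
    rw [prod_altWord_even, ← mul_one ((g x * g (!x)) ^ n)]
    refine trace_pow_mul (hsq x) ?_ ?_ n
    · simp [hC2]
    · rw [mul_one, htr'']
  have hrefl : ∀ x n, ((altWord x (2 * n + 1)).map g).prod.trace =
      q ^ n * (q - 1) * RatFunc.C (chebyshevSeq t 1 (1 + t) n : ℂ) := by
    intro x n
    rw [prod_altWord_odd]
    exact trace_pow_mul (hsq x) (htr x) (htr' x) n
  refine ordZero_genericDegree 1 (d := 2) two_ne_zero ?_ (.sr 0) ?_
  · rw [hχ, DihedralGroup.one_def]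
    simp [redWord, altWord, hC2]
  · rintro (k | k)
    · obtain ⟨n, x, y, -, hx, hy⟩ := redWord_r k
      refine ⟨X * C ((chebyshevSeq t 2 t n : ℂ) ^ 2), 0, le_rfl, by simp, by simp, ?_⟩
      rw [DihedralGroup.inv_r, hχ, hχ, hx, hy, hrot, hrot, len_eq_of_redWord hx]
      simp only [map_mul, map_pow, RatFunc.algebraMap_X, RatFunc.algebraMap_C]
      change _ = q * _
      field_simp
      ring
    · obtain ⟨n, x, -, hx⟩ := redWord_sr k
      refine ⟨(X - 1) ^ 2 * C ((chebyshevSeq t 1 (1 + t) n : ℂ) ^ 2),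
        chebyshevSeq t 1 (1 + t) n ^ 2, sq_nonneg _, ?_, by simp, ?_⟩
      · intro hk
        rw [hk, redWord_sr_zero] at hx
        rw [(altWord_odd_inj hx.symm).2]
        simp [chebyshevSeq]
      · rw [DihedralGroup.inv_sr, hχ, hx, hrefl, len_eq_of_redWord hx]
        simp only [map_mul, map_pow, map_sub, map_one, RatFunc.algebraMap_X, RatFunc.algebraMap_C]
        change _ = (q - 1) ^ 2 * _
        field_simp
        ring

theorem one_lt_half_add_one {m : ℕ} (hm : 3 ≤ m) : 1 < m / 2 + 1 := by omega

/-- The special characters are `χ_0`, `χ_1` and the sign character. -/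
theorem isSpecial_iff {m : ℕ} [NeZero m] (hm : 3 ≤ m) (χ : Irr m) :
    IsSpecial χ ↔ χ = .chi 0 ∨ χ = .chi ⟨1, one_lt_half_add_one hm⟩ ∨ χ = .eps := by
  have hmid : χ ≠ .chi 0 → χ ≠ .eps → ordZero (genericDegree χ) = 1 := by
    intro h h'
    rcases χ with i | he | _
    · have h0 : i.val ≠ 0 := by
        intro h0
        exact h (congrArg _ (Fin.ext h0))
      by_cases h2 : 2 * i.val = m
      · refine ordZero_genericDegree_mixed (x := q) (y := -1) ?_ false rfl rfl
          (redWord_sr_one hm)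
        intro w
        simp only [heckeChar, if_neg h0, if_pos h2]
      · exact ordZero_genericDegree_two_dim h0 h2
    · exact ordZero_genericDegree_mixed (x := -1) (y := q) (fun _ => rfl) true rfl rfl
        redWord_sr_zero
    · exact absurd rfl h'
  by_cases h0 : χ = .chi 0
  · subst h0
    simp [IsSpecial, b_chi_zero, ordZero_genericDegree_trivial]
  · by_cases he : χ = .eps
    · subst he
      simp [IsSpecial, b_eps, ordZero_genericDegree_sign]
    · rw [IsSpecial, hmid h0 he, b_of_ne_eps (by omega) he]
      simp only [h0, he, false_or, or_false]
      constructor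
      · intro h
        have h1 : χ.idx = 1 := by exact_mod_cast h
        rcases χ with i | hev | _
        · exact congrArg _ (Fin.ext h1)
        · simp only [Irr.idx] at h1
          obtain ⟨n, hn⟩ := hev
          omega
        · exact absurd rfl he
      · rintro rfl
        rfl

open Matrix

/-- There are at most two linear characters other than the trivial and the sign character. -/
theorem Irr.eq_of_two_mul_idx {m : ℕ} (hm : 2 ≤ m) {χ ψ φ : Irr m} (h₁ : 2 * χ.idx = m)
    (h₂ : 2 * ψ.idx = m) (h₃ : 2 * φ.idx = m) (hχψ : χ ≠ ψ) (hχφ : χ ≠ φ) : ψ = φ := by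
  by_contra hψφ
  have e₁ : χ.reflCoeff ≠ ψ.reflCoeff := fun h => hχψ (Irr.ext_idx_reflCoeff hm (by omega) h)
  have e₂ : χ.reflCoeff ≠ φ.reflCoeff := fun h => hχφ (Irr.ext_idx_reflCoeff hm (by omega) h)
  have e₃ : ψ.reflCoeff ≠ φ.reflCoeff := fun h => hψφ (Irr.ext_idx_reflCoeff hm (by omega) h)
  rcases Irr.reflCoeff_of_linear (Or.inr h₁) with a₁ | a₁ <;>
    rcases Irr.reflCoeff_of_linear (Or.inr h₂) with a₂ | a₂ <;>
    rcases Irr.reflCoeff_of_linear (Or.inr h₃) with a₃ | a₃ <;>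
    simp_all

/-! ### Cancellation in a block-triangular system -/

section GreenSystem

variable {m : ℕ} [NeZero m] {D : LSDatum (Irr m)} {P Λ : Matrix (Irr m) (Irr m) K}

theorem IsGreenSystem.vecMul_row (h : IsGreenSystem D P Λ) (χ : Irr m) :
    P χ ᵥ* (Λ * P.transpose) = Omega m χ := by
  rw [← h.equation, Matrix.mul_assoc]
  rfl

theorem IsGreenSystem.det_ne_zero (h : IsGreenSystem D P Λ) (hm : 2 ≤ m) [DecidableEq (Irr m)] :
    Λ.det ≠ 0 := by
  intro h0
  apply det_Omega_ne_zero (m := m) hm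
  rw [← h.equation]
  convert (show (P * Λ * P.transpose).det = 0 by
    rw [Matrix.det_mul, Matrix.det_mul, h0, mul_zero, zero_mul])

/-- A row vector whose product with `Λ Pᵗ` vanishes on a class vanishes on that class, as soon as
the smaller classes do not contribute. -/
theorem IsGreenSystem.eq_zero_of_vecMul (h : IsGreenSystem D P Λ) (hm : 2 ≤ m) {v : Irr m → K}
    {C : D.X}
    (h₁ : ∀ φ ψ χ, D.supp φ = D.supp ψ → D.supp φ < C → D.supp χ = C → v φ = 0 ∨ P χ ψ = 0)
    (h₂ : ∀ χ, D.supp χ = C → (v ᵥ* (Λ * P.transpose)) χ = 0) {φ : Irr m} (hφ : D.supp φ = C) :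
    v φ = 0 := by
  classical
  -- Restricting v to C reduces the claim to w Λ = 0, since Λ is invertible. In a column indexed by
  -- C, Λ couples only members of one class: classes above C drop out by triangularity of P, those
  -- below by `h₁`, and within C the matrix P is the scalar q^(a_C).
  let w : Irr m → K := fun φ => if D.supp φ = C then v φ else 0
  have hw : w ᵥ* Λ = 0 := by
    ext χ
    by_cases hχ : D.supp χ = C
    · have h3 := h₂ χ hχ
      have h4 : ∀ φ, v φ * (Λ * P.transpose) φ χ = w φ * Λ φ χ * q ^ D.a C := by
        intro φ
        rw [Matrix.mul_apply, Finset.mul_sum, Finset.sum_eq_single χ]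
        · by_cases hφ : D.supp φ = C
          · simp only [w, if_pos hφ, Matrix.transpose_apply, h.P_diag, hχ]
            ring
          · have : Λ φ χ = 0 := h.Λ_block _ _ (by rwa [hχ])
            rw [this]
            ring
        · intro ψ _ hψ
          rw [Matrix.transpose_apply]
          by_cases hs : D.supp φ = D.supp ψ
          · rcases lt_trichotomy (D.supp φ) C with hlt | heq | hgt
            · rcases h₁ φ ψ χ hs hlt hχ with h0 | h0 <;> rw [h0] <;> ring
            · rw [h.P_block χ ψ (by rw [hχ, ← hs, heq]) hψ.symm]
              ring
            · rw [h.P_lt χ ψ (by rwa [hχ, ← hs])]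
              ring
          · rw [h.Λ_block _ _ hs]
            ring
        · simp
      have h5 : (∑ φ, w φ * Λ φ χ) * q ^ D.a C = 0 := by
        rw [Finset.sum_mul, ← Finset.sum_congr rfl fun φ _ => h4 φ]
        exact h3
      exact (mul_eq_zero.1 h5).resolve_right (pow_ne_zero _ q_ne_zero)
    · refine Finset.sum_eq_zero fun φ _ => ?_
      change w φ * Λ φ χ = 0
      by_cases hφ : D.supp φ = C
      · rw [h.Λ_block φ χ (by rw [hφ]; exact fun e => hχ e.symm), mul_zero]
      · simp only [w, if_neg hφ, zero_mul]
  have h0 := congrFun (Matrix.eq_zero_of_vecMul_eq_zero (h.det_ne_zero hm) hw) φ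
  simpa only [w, if_pos hφ, Pi.zero_apply] using h0

end GreenSystem

open Classical in
/-- A row of `P` with its entry at the sign character removed. -/
def truncRow {m : ℕ} (P : Matrix (Irr m) (Irr m) K) (χ : Irr m) : Irr m → K :=
  P χ - Pi.single .eps (P χ .eps)

theorem truncRow_eps {m : ℕ} {P : Matrix (Irr m) (Irr m) K} (χ : Irr m) :
    truncRow P χ .eps = 0 := by
  simp [truncRow]

theorem truncRow_of_ne {m : ℕ} {P : Matrix (Irr m) (Irr m) K} {χ φ : Irr m} (h : φ ≠ .eps) :
    truncRow P χ φ = P χ φ := by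
  simp [truncRow, h]

theorem icMult_of_eq_pow {m : ℕ} {D : LSDatum (Irr m)} {P : Matrix (Irr m) (Irr m) K}
    {χ ψ : Irr m} (h : P χ ψ = q ^ D.a (D.supp χ)) (i : ℕ) :
    icMult D P χ ψ i = if i = 0 then 1 else 0 := by
  have : (q ^ D.a (D.supp χ)).num = Polynomial.X ^ D.a (D.supp χ) := by
    rw [q, ← RatFunc.algebraMap_X, ← map_pow, RatFunc.num_algebraMap]
  rw [icMult, h, this, Polynomial.coeff_X_pow]
  simp

theorem icMult_of_eq_zero {m : ℕ} {D : LSDatum (Irr m)} {P : Matrix (Irr m) (Irr m) K}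
    {χ ψ : Irr m} (h : P χ ψ = 0) (i : ℕ) : icMult D P χ ψ i = 0 := by
  rw [icMult, h, RatFunc.num_zero, Polynomial.coeff_zero]

/-! ### The sign character's class and the rows of `P` -/

namespace IsSpringerCorrespondence

variable {m : ℕ} [NeZero m] {D : LSDatum (Irr m)} {P Λ : Matrix (Irr m) (Irr m) K}

theorem a_le_b (hD : IsSpringerCorrespondence D P Λ) (χ : Irr m) :
    (D.a (D.supp χ) : ℤ) ≤ b χ :=
  (hD.a_eq_min _).2 ⟨χ, rfl, rfl⟩

theorem a_eq_b (hD : IsSpringerCorrespondence D P Λ) {χ : Irr m} (h : IsSpringerRep D χ) :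
    (D.a (D.supp χ) : ℤ) = b χ := by
  refine le_antisymm (hD.a_le_b χ) ?_
  obtain ⟨ψ, hψ, he⟩ := (hD.a_eq_min (D.supp χ)).1
  rw [← he]
  exact h ψ hψ

theorem springer_unique (hD : IsSpringerCorrespondence D P Λ) {χ ψ : Irr m}
    (hχ : IsSpringerRep D χ) (hψ : IsSpringerRep D ψ) (h : D.supp χ = D.supp ψ) : χ = ψ :=
  (hD.unique_springer (D.supp ψ)).unique ⟨h, hχ⟩ ⟨rfl, hψ⟩

theorem springer_of_b_le_a (hD : IsSpringerCorrespondence D P Λ) {χ : Irr m}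
    (h : b χ ≤ D.a (D.supp χ)) : IsSpringerRep D χ := by
  intro ψ hψ
  have := hD.a_le_b ψ
  rw [hψ] at this
  exact h.trans this

theorem springer_eps (hD : IsSpringerCorrespondence D P Λ) (hm : 3 ≤ m) :
    IsSpringerRep D (.eps : Irr m) :=
  hD.special_springer _ ((isSpecial_iff hm _).2 (Or.inr (Or.inr rfl)))

theorem springer_chi_zero (hD : IsSpringerCorrespondence D P Λ) (hm : 3 ≤ m) :
    IsSpringerRep D (.chi 0 : Irr m) :=
  hD.special_springer _ ((isSpecial_iff hm _).2 (Or.inl rfl))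

theorem springer_chi_one (hD : IsSpringerCorrespondence D P Λ) (hm : 3 ≤ m) :
    IsSpringerRep D (.chi ⟨1, one_lt_half_add_one hm⟩ : Irr m) :=
  hD.special_springer _ ((isSpecial_iff hm _).2 (Or.inr (Or.inl rfl)))

theorem a_eps (hD : IsSpringerCorrespondence D P Λ) (hm : 3 ≤ m) :
    D.a (D.supp (.eps : Irr m)) = m := by
  have h := hD.a_eq_b (hD.springer_eps hm)
  rw [b_eps] at h
  exact_mod_cast h

theorem a_le_idx (hD : IsSpringerCorrespondence D P Λ) (hm : 3 ≤ m) {χ : Irr m} (h : χ ≠ .eps) :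
    D.a (D.supp χ) ≤ χ.idx := by
  have := hD.a_le_b χ
  rw [b_of_ne_eps (by omega) h] at this
  exact_mod_cast this

theorem a_eq_idx (hD : IsSpringerCorrespondence D P Λ) (hm : 3 ≤ m) {χ : Irr m} (h : χ ≠ .eps)
    (hχ : IsSpringerRep D χ) : D.a (D.supp χ) = χ.idx := by
  have := hD.a_eq_b hχ
  rw [b_of_ne_eps (by omega) h] at this
  exact_mod_cast this

/-- The value of a at ε is m, whereas on any other character a is at most its index, which is less
than m; since a is order-reversing, ε must lie strictly below. -/
theorem supp_eps_lt (hD : IsSpringerCorrespondence D P Λ) (hm : 3 ≤ m) {χ : Irr m}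
    (h : χ ≠ .eps) : D.supp .eps < D.supp χ := by
  by_contra hle
  have h1 := D.antitone_a (not_lt.1 hle)
  rw [hD.a_eps hm] at h1
  have h2 := hD.a_le_idx hm h
  have := χ.idx_lt
  omega

theorem eq_eps_of_supp_eq (hD : IsSpringerCorrespondence D P Λ) (hm : 3 ≤ m) {χ : Irr m}
    (h : D.supp χ = D.supp .eps) : χ = .eps := by
  by_contra hne
  exact (hD.supp_eps_lt hm hne).ne' h

theorem mul_transpose_eps (hD : IsSpringerCorrespondence D P Λ) (hm : 3 ≤ m) (ψ : Irr m) :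
    (Λ * P.transpose) .eps ψ = Λ .eps .eps * P ψ .eps := by
  rw [Matrix.mul_apply, Finset.sum_eq_single (.eps : Irr m)]
  · rfl
  · intro φ _ hφ
    rw [hD.green.Λ_block _ _ (hD.supp_eps_lt hm hφ).ne, zero_mul]
  · simp

/-- In the column of ε only one term of P Λ Pᵗ survives, because the class of ε is a singleton below
all others. -/
theorem Omega_eps_eq (hD : IsSpringerCorrespondence D P Λ) (hm : 3 ≤ m) (χ : Irr m) :
    P χ .eps * (Λ .eps .eps * q ^ m) = Omega m χ .eps := by
  rw [← congrFun (hD.green.vecMul_row χ) .eps]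
  change _ = ∑ φ, P χ φ * (Λ * P.transpose) φ .eps
  rw [Finset.sum_eq_single (.eps : Irr m)]
  · rw [hD.mul_transpose_eps hm, hD.green.P_diag, hD.a_eps hm]
  · intro φ _ hφ
    rw [Matrix.mul_apply, Finset.sum_eq_zero, mul_zero]
    intro ψ _
    by_cases hψ : ψ = .eps
    · rw [hψ, hD.green.Λ_block _ _ (hD.supp_eps_lt hm hφ).ne', zero_mul]
    · rw [Matrix.transpose_apply, hD.green.P_lt _ _ (hD.supp_eps_lt hm hψ), mul_zero]
  · simp

theorem Lambda_eps (hD : IsSpringerCorrespondence D P Λ) (hm : 3 ≤ m) :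
    Λ .eps .eps = 1 := by
  have h := hD.Omega_eps_eq hm .eps
  rw [hD.green.P_diag, hD.a_eps hm, Omega_eps, R_eps] at h
  have hq := pow_ne_zero m q_ne_zero
  have h1 := mul_left_cancel₀ hq h
  exact mul_right_cancel₀ hq (h1.trans (one_mul _).symm)

theorem P_eps (hD : IsSpringerCorrespondence D P Λ) (hm : 3 ≤ m) (χ : Irr m) :
    P χ .eps = R χ.char := by
  have h := hD.Omega_eps_eq hm χ
  rw [hD.Lambda_eps hm, Omega_eps, one_mul, mul_comm] at h
  exact mul_left_cancel₀ (pow_ne_zero m q_ne_zero) h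

theorem truncRow_vecMul (hD : IsSpringerCorrespondence D P Λ) (hm : 3 ≤ m) (χ ψ : Irr m) :
    (truncRow P χ ᵥ* (Λ * P.transpose)) ψ = Omega m χ ψ - R χ.char * R ψ.char := by
  classical
  rw [truncRow, Matrix.sub_vecMul, hD.green.vecMul_row, Pi.sub_apply]
  congr 1
  change ∑ φ, _ * _ = _
  rw [Finset.sum_eq_single (.eps : Irr m)]
  · rw [hD.mul_transpose_eps hm, hD.Lambda_eps hm, hD.P_eps hm, hD.P_eps hm, one_mul]
    simp
  · intro φ _ hφ
    simp [hφ]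
  · simp

theorem sub_smul_truncRow_vecMul (hD : IsSpringerCorrespondence D P Λ) (hm : 3 ≤ m) (x : K)
    (χ ψ : Irr m) :
    ((truncRow P χ - x • truncRow P (.chi 0)) ᵥ* (Λ * P.transpose)) ψ =
      Omega m χ ψ - R χ.char * R ψ.char - x * (Omega m (.chi 0) ψ - R ψ.char) := by
  rw [Matrix.sub_vecMul, Matrix.smul_vecMul, Pi.sub_apply, Pi.smul_apply, hD.truncRow_vecMul hm,
    hD.truncRow_vecMul hm, R_chi_zero, one_mul, smul_eq_mul]

/-- On the classes `C` with `a_C ≥ k`, the row of `χ_k` in `P` is `q ^ k` times that of `χ_0`. -/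
theorem truncRow_eq (hD : IsSpringerCorrespondence D P Λ) (hm : 3 ≤ m) {χ : Irr m}
    (h0 : χ.idx ≠ 0) (h2 : 2 * χ.idx < m) (C : D.X) (hC : χ.idx ≤ D.a C) {φ : Irr m}
    (hφ : D.supp φ = C) : (truncRow P χ - q ^ χ.idx • truncRow P (.chi 0)) φ = 0 := by
  have : Finite D.X := Finite.of_surjective D.supp D.supp_surjective
  induction C using (wellFounded_lt (α := D.X)).induction generalizing φ with
  | _ C ih =>
    refine hD.green.eq_zero_of_vecMul (by omega) ?_ ?_ hφ
    · intro φ' _ _ _ hlt _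
      -- Smaller classes have larger a, so the bound persists and the induction hypothesis applies.
      exact Or.inl (ih _ hlt (hC.trans (D.antitone_a hlt.le)) rfl)
    · intro ψ hψ
      rw [hD.sub_smul_truncRow_vecMul hm]
      by_cases he : ψ = .eps
      · rw [he, Omega_eps, Omega_eps, R_eps, R_chi_zero]
        ring
      · have h1 := hD.a_le_idx hm he
        rw [hψ] at h1
        rw [Omega_sub_of_idx_le h0 h2 (hC.trans h1), sub_self]

theorem P_eq_mul (hD : IsSpringerCorrespondence D P Λ) (hm : 3 ≤ m) {χ : Irr m}
    (h0 : χ.idx ≠ 0) (h2 : 2 * χ.idx < m) {φ : Irr m} (hφ : φ ≠ .eps)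
    (ha : χ.idx ≤ D.a (D.supp φ)) : P χ φ = q ^ χ.idx * P (.chi 0) φ := by
  have h := hD.truncRow_eq hm h0 h2 _ ha rfl
  rw [Pi.sub_apply, Pi.smul_apply, truncRow_of_ne hφ, truncRow_of_ne hφ] at h
  exact sub_eq_zero.1 h

theorem two_mul_idx_of_le (hD : IsSpringerCorrespondence D P Λ) (hm : 3 ≤ m) {χ φ : Irr m}
    (h : 2 * χ.idx = m) (hφ : φ ≠ .eps) (ha : χ.idx ≤ D.a (D.supp φ)) : 2 * φ.idx = m := by
  have := hD.a_le_idx hm hφ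
  have := φ.two_mul_idx_le
  omega

/-- The class of χ is a singleton, and below it only ε and the other character of index m/2 can
occur. The reduced entry of that pair is 0, so P vanishes from χ to the other character, which then
contributes nothing in the column of χ even though the two rows are not proportional there. -/
theorem P_chi_zero_of_two_mul_idx (hD : IsSpringerCorrespondence D P Λ) (hm : 3 ≤ m) {χ : Irr m}
    (h : 2 * χ.idx = m) (hχ : IsSpringerRep D χ) : P (.chi 0) χ = 1 := by
  have hm2 : 2 ≤ m := by omega
  have hne : χ ≠ .eps := by
    rintro rfl
    simp only [Irr.idx] at h
    omega
  have ha := hD.a_eq_idx hm hne hχ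
  have hsing : ∀ ψ, D.supp ψ = D.supp χ → ψ = χ := by
    intro ψ hψ
    have hψe : ψ ≠ .eps := by
      rintro rfl
      exact hne (hD.eq_eps_of_supp_eq hm hψ.symm)
    have h1 := hD.two_mul_idx_of_le hm h hψe (by rw [hψ, ha])
    refine hD.springer_unique (hD.springer_of_b_le_a ?_) hχ hψ
    rw [b_of_ne_eps hm2 hψe, hψ, ha]
    exact_mod_cast (by omega : ψ.idx ≤ χ.idx)
  have hP : ∀ ψ, ψ ≠ .eps → D.supp ψ < D.supp χ → P χ ψ = 0 := by
    intro ψ hψ hlt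
    have hle : ∀ φ, D.supp φ ≤ D.supp ψ → χ.idx ≤ D.a (D.supp φ) := fun φ hφ =>
      ha ▸ D.antitone_a (hφ.trans hlt.le)
    have hψ2 := hD.two_mul_idx_of_le hm h hψ (hle ψ le_rfl)
    rw [← truncRow_of_ne (P := P) hψ]
    refine hD.green.eq_zero_of_vecMul hm2 (C := D.supp ψ) ?_ ?_ rfl
    · intro φ _ _ _ hφ _
      by_cases he : φ = .eps
      · rw [he]
        exact Or.inl (truncRow_eps χ)
      · have hφ2 := hD.two_mul_idx_of_le hm h he (hle φ hφ.le)
        -- A third character of index m/2 does not exist, so nothing but ε lies below ψ.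
        have := Irr.eq_of_two_mul_idx hm2 h hψ2 hφ2 (by rintro rfl; exact hlt.ne rfl)
          (by rintro rfl; exact (hφ.trans hlt).ne rfl)
        rw [this] at hφ
        exact absurd hφ (lt_irrefl _)
    · intro φ hφ
      have he : φ ≠ .eps := by
        rintro rfl
        exact hψ (hD.eq_eps_of_supp_eq hm hφ.symm)
      rw [hD.truncRow_vecMul hm]
      refine Omega_of_two_mul_idx hm2 h (hD.two_mul_idx_of_le hm h he (hle φ hφ.le)) ?_
      rintro rfl
      exact hlt.ne hφ.symm
  have h0 : (truncRow P χ - q ^ χ.idx • truncRow P (.chi 0)) χ = 0 := by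
    refine hD.green.eq_zero_of_vecMul hm2 (C := D.supp χ) ?_ ?_ rfl
    · intro φ ψ ρ hφψ hlt hρ
      by_cases he : φ = .eps
      · left
        rw [he, Pi.sub_apply, Pi.smul_apply, truncRow_eps, truncRow_eps, smul_zero, sub_zero]
      · right
        rw [hsing ρ hρ]
        refine hP ψ ?_ (hφψ ▸ hlt)
        rintro rfl
        exact he (hD.eq_eps_of_supp_eq hm hφψ)
    · intro ρ hρ
      rw [hsing ρ hρ, hD.sub_smul_truncRow_vecMul hm, Omega_self_of_two_mul_idx h, sub_self]
  rw [Pi.sub_apply, Pi.smul_apply, truncRow_of_ne hne, truncRow_of_ne hne, hD.green.P_diag, ha,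
    smul_eq_mul, sub_eq_zero] at h0
  exact mul_left_cancel₀ (pow_ne_zero _ q_ne_zero) (h0.symm.trans (mul_one _).symm)

theorem a_chi_zero (hD : IsSpringerCorrespondence D P Λ) (hm : 3 ≤ m) :
    D.a (D.supp (.chi 0 : Irr m)) = 0 :=
  hD.a_eq_idx hm (by simp) (hD.springer_chi_zero hm)

theorem a_chi_one (hD : IsSpringerCorrespondence D P Λ) (hm : 3 ≤ m) :
    D.a (D.supp (.chi ⟨1, one_lt_half_add_one hm⟩ : Irr m)) = 1 :=
  hD.a_eq_idx hm (by simp) (hD.springer_chi_one hm)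

theorem P_chi_zero (hD : IsSpringerCorrespondence D P Λ) (hm : 3 ≤ m) (φ : Irr m) :
    (IsSpringerRep D φ → P (.chi 0) φ = 1) ∧ (¬ IsSpringerRep D φ → P (.chi 0) φ = 0) := by
  have hm2 : 2 ≤ m := by omega
  obtain ⟨s, ⟨hs, hsp⟩, huniq⟩ := hD.unique_springer (D.supp φ)
  have key : ∀ x : K, (φ = s → x = 1) → (φ ≠ s → x = 0) →
      (IsSpringerRep D φ → x = 1) ∧ (¬ IsSpringerRep D φ → x = 0) := by
    intro x h₁ h₂
    refine ⟨fun h => h₁ (huniq φ ⟨rfl, h⟩), fun h => h₂ ?_⟩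
    rintro rfl
    exact h hsp
  by_cases he : s = .eps
  · have hφ : φ = .eps := hD.eq_eps_of_supp_eq hm (by rw [← hs, he])
    apply key
    · intro _
      rw [hφ, hD.P_eps hm, R_chi_zero]
    · intro hne
      exact absurd (hφ.trans he.symm) hne
  · have ha : D.a (D.supp φ) = s.idx := by rw [← hs, hD.a_eq_idx hm he hsp]
    have hφe : φ ≠ .eps := by
      rintro rfl
      exact he (hD.eq_eps_of_supp_eq hm hs)
    -- Three cases for the Springer representation s of the class: χ_0 itself, where the row is read
    -- off the diagonal block; two-dimensional, where row s is divided by q^(a_C); and index m/2.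
    by_cases h0 : s.idx = 0
    · have hs0 : s = .chi 0 := (Irr.eq_of_idx_eq_zero hm2 h0).resolve_right he
      apply key
      · intro hφ
        rw [hφ, hs0, hD.green.P_diag, hD.a_chi_zero hm, pow_zero]
      · intro hne
        rw [hs0] at hs hne
        exact hD.green.P_block _ _ hs hne.symm
    · rcases (s.two_mul_idx_le).lt_or_eq with h2 | h2
      · have h := hD.P_eq_mul hm h0 h2 hφe ha.ge
        apply key
        · intro hφ
          rw [hφ, hD.green.P_diag, hD.a_eq_idx hm he hsp] at h
          rw [hφ]
          exact mul_left_cancel₀ (pow_ne_zero _ q_ne_zero) (h.symm.trans (mul_one _).symm)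
        · intro hne
          rw [hD.green.P_block _ _ hs hne.symm] at h
          exact (mul_eq_zero.1 h.symm).resolve_left (pow_ne_zero _ q_ne_zero)
      · have hφ2 := hD.two_mul_idx_of_le hm h2 hφe ha.ge
        have hφs : φ = s := by
          refine hD.springer_unique (hD.springer_of_b_le_a ?_) hsp hs.symm
          rw [b_of_ne_eps hm2 hφe, ha]
          exact_mod_cast (by omega : φ.idx ≤ s.idx)
        apply key
        · intro _
          rw [hφs]
          exact hD.P_chi_zero_of_two_mul_idx hm h2 hsp
        · intro hne
          exact absurd hφs hne

theorem supp_chi_one_lt (hD : IsSpringerCorrespondence D P Λ) (hm : 3 ≤ m) :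
    D.supp (.chi ⟨1, one_lt_half_add_one hm⟩ : Irr m) < D.supp (.chi 0) := by
  by_contra h
  have h1 := D.antitone_a (not_lt.1 h)
  rw [hD.a_chi_zero hm, hD.a_chi_one hm] at h1
  omega

theorem P_chi_one (hD : IsSpringerCorrespondence D P Λ) (hm : 3 ≤ m) {φ : Irr m}
    (h0 : φ ≠ .chi 0) (he : φ ≠ .eps) :
    (IsSpringerRep D φ → P (.chi ⟨1, one_lt_half_add_one hm⟩) φ = q) ∧
      (¬ IsSpringerRep D φ → P (.chi ⟨1, one_lt_half_add_one hm⟩) φ = 0) := by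
  have hm2 : 2 ≤ m := by omega
  by_cases ha : 1 ≤ D.a (D.supp φ)
  · have h : P (.chi ⟨1, one_lt_half_add_one hm⟩) φ = q ^ 1 * P (.chi 0) φ :=
      hD.P_eq_mul hm (χ := .chi ⟨1, one_lt_half_add_one hm⟩) one_ne_zero
        (show 2 * 1 < m by omega) he ha
    rw [h, pow_one]
    refine ⟨fun hs => ?_, fun hs => ?_⟩
    · rw [(hD.P_chi_zero hm φ).1 hs, mul_one]
    · rw [(hD.P_chi_zero hm φ).2 hs, mul_zero]
  -- A class with a = 0 is the class of χ_0, which lies strictly above that of χ_1, so triangularity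
  -- gives zero.
  · obtain ⟨s, ⟨hs, hsp⟩, -⟩ := hD.unique_springer (D.supp φ)
    have hse : s ≠ .eps := by
      rintro rfl
      exact he (hD.eq_eps_of_supp_eq hm hs.symm)
    have hs0 : s = .chi 0 := by
      refine (Irr.eq_of_idx_eq_zero hm2 ?_).resolve_right hse
      rw [← hD.a_eq_idx hm hse hsp, hs]
      omega
    refine ⟨fun h => ?_, fun _ => ?_⟩
    · exact absurd ((hD.springer_unique h hsp hs.symm).trans hs0) h0
    · apply hD.green.P_lt
      rw [← hs, hs0]
      exact hD.supp_chi_one_lt hm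

/-! ### Closure order and rational smoothness -/

theorem le_of_closureLE (hD : IsSpringerCorrespondence D P Λ) {C' C : D.X}
    (h : ClosureLE D P C' C) : C' ≤ C := by
  have step : ∀ {B' B : D.X}, (∃ χ χ', D.supp χ = B ∧ D.supp χ' = B' ∧ P χ χ' ≠ 0) → B' ≤ B := by
    rintro _ _ ⟨χ, χ', rfl, rfl, hne⟩
    by_contra hlt
    exact hne (hD.green.P_lt _ _ (not_le.1 hlt))
  induction h with
  | single h => exact step h
  | tail _ h ih => exact ih.trans (step h)

theorem rationallySmooth (hD : IsSpringerCorrespondence D P Λ) {Z : Set D.X} {χ : Irr m}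
    (hχ : IsSpringerRep D χ) (hZ : D.supp χ ∈ Z)
    (h : ∀ ψ, D.supp ψ ∈ Z → (IsSpringerRep D ψ → P χ ψ = q ^ D.a (D.supp χ)) ∧
      (¬ IsSpringerRep D ψ → P χ ψ = 0)) : RationallySmooth D P Z := by
  refine ⟨D.supp χ, hZ, ?_, ?_⟩
  · intro C' hC'
    obtain ⟨s, ⟨rfl, hsp⟩, -⟩ := hD.unique_springer C'
    refine Relation.TransGen.single ⟨χ, s, rfl, rfl, ?_⟩
    rw [(h s hC').1 hsp]
    exact pow_ne_zero _ q_ne_zero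
  · intro ρ hρ hsp ψ hψ
    obtain rfl := hD.springer_unique hsp hχ hρ
    by_cases hs : IsSpringerRep D ψ
    · have h1 := icMult_of_eq_pow ((h ψ hψ).1 hs)
      refine ⟨fun _ => by rw [h1, if_pos rfl], fun hn => absurd hs hn, fun i hi => ?_⟩
      rw [h1, if_neg (by omega)]
    · have h1 := icMult_of_eq_zero (D := D) ((h ψ hψ).2 hs)
      exact ⟨fun hn => absurd hn hs, fun _ => h1 0, fun i _ => h1 i⟩

theorem rationallySmooth_of_chi_zero (hD : IsSpringerCorrespondence D P Λ) (hm : 3 ≤ m)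
    {Z : Set D.X} (hZ : D.supp (.chi 0) ∈ Z) : RationallySmooth D P Z := by
  refine hD.rationallySmooth (hD.springer_chi_zero hm) hZ fun ψ _ => ?_
  rw [hD.a_chi_zero hm, pow_zero]
  exact hD.P_chi_zero hm ψ

/-- The row of χ_0 works for any set of classes containing its class. The piece of χ_1 contains
neither χ_0 nor ε, whose classes are special and different from that of χ_1. The piece of ε is one
class, since nothing lies below it. -/
theorem rationallySmooth_specialPiece (hD : IsSpringerCorrespondence D P Λ) (hm : 3 ≤ m) {C : D.X}
    (hC : IsSpecialClass D C) : RationallySmooth D P (specialPiece D P C) := by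
  obtain ⟨χ, rfl, hχ, hspec⟩ := hC
  have hmem : D.supp χ ∈ specialPiece D P (D.supp χ) := Or.inl rfl
  have h_one_eps : (.chi ⟨1, one_lt_half_add_one hm⟩ : Irr m) ≠ .eps := by simp
  rcases (isSpecial_iff hm χ).1 hspec with rfl | rfl | rfl
  · exact hD.rationallySmooth_of_chi_zero hm hmem
  · refine hD.rationallySmooth hχ hmem fun ψ hψ => ?_
    rw [hD.a_chi_one hm, pow_one]
    apply hD.P_chi_one hm
    · rintro rfl
      rcases hψ with hψ | hψ
      · exact (hD.supp_chi_one_lt hm).ne' hψ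
      · exact hψ.1 ⟨_, rfl, hD.springer_chi_zero hm, (isSpecial_iff hm _).2 (Or.inl rfl)⟩
    · rintro rfl
      rcases hψ with hψ | hψ
      · exact (hD.supp_eps_lt hm h_one_eps).ne hψ
      · exact hψ.1 ⟨_, rfl, hD.springer_eps hm, (isSpecial_iff hm _).2 (Or.inr (Or.inr rfl))⟩
  · refine hD.rationallySmooth hχ hmem fun ψ hψ => ?_
    have : ψ = .eps := by
      by_contra hne
      have hlt := hD.supp_eps_lt hm hne
      rcases hψ with hψ | hψ
      · exact hlt.ne' hψ
      · exact hlt.not_ge (hD.le_of_closureLE hψ.2.1)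
    subst this
    exact ⟨fun _ => hD.green.P_diag _, fun hn => absurd hχ hn⟩

end IsSpringerCorrespondence

end DihedralSpringer

end

open DihedralSpringer
theorem theorem3p2 (m : ℕ) [NeZero m] (hm : 3 ≤ m) (D : LSDatum (Irr m))
    (P Λ : Matrix (Irr m) (Irr m) K) (hD : IsSpringerCorrespondence D P Λ) :
    (∀ C : D.X, IsSpecialClass D C → RationallySmooth D P (specialPiece D P C)) ∧
    RationallySmooth D P Set.univ ∧
    (∀ χ : Irr m, χ ≠ Irr.chi 0 → χ ≠ Irr.eps →
      (IsSpringerRep D χ → P (Irr.chi ⟨1, by omega⟩) χ = q) ∧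
      (¬ IsSpringerRep D χ → P (Irr.chi ⟨1, by omega⟩) χ = 0)) ∧
    (∀ χ : Irr m,
      (IsSpringerRep D χ → P (Irr.chi 0) χ = 1) ∧
      (¬ IsSpringerRep D χ → P (Irr.chi 0) χ = 0)) :=
  ⟨fun _ hC => hD.rationallySmooth_specialPiece hm hC,
    hD.rationallySmooth_of_chi_zero hm (Set.mem_univ _),
    fun _ h0 he => hD.P_chi_one hm h0 he, fun χ => hD.P_chi_zero hm χ⟩
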